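/- Let $p$ be an odd prime. For elements $x,y$ of a group write $[x,y]=x^{-1}y^{-1}xy$, and for groups $A_1,\dots,A_n$ of class at most two let $A_1\amalg^{\mathfrak N_2}\cdots\amalg^{\mathfrak N_2}A_n=F/F_3$ denote their $2$-nilpotent product, where $F=A_1*\cdots*A_n$ is the free product and $F_3=[[F,F],F]$. If $H\le Z(A)$ and $\phi\colon H\to Z(B)$ is an embedding, let $A\times_\phi B=(A\times B)/\{(h,\phi(h)^{-1})\mid h\in H\}$ be the amalgamated direct product. A group $G$ is capable if $G\cong K/Z(K)$ for some group $K$. Let $E$ be the extra-special $p$-group of order $p^5$ and exponent $p$ (which exists and is unique up to isomorphism), and let $C_p$ be the cyclic group of order $p$. Let $G$ be a group of nilpotency class at most two and exponent $p$ that can be generated by $5$ elements but not by fewer. Then $G$ is one and only one of the following: (i) isomorphic to the direct product $E\times C_p$; (ii) isomorphic to the amalgamated direct product \[\bigl(\langle x_1\rangle\amalg^{\mathfrak N_2}\langle x_2\rangle\bigr)\times_\phi\bigl(\langle x_3\rangle\amalg^{\mathfrak N_2}\langle x_4\rangle\amalg^{\mathfrak N_2}\langle x_5\rangle\bigr),\]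 with each $x_i$ of order $p$, where $\phi$ is the embedding of $\langle[x_2,x_1]\rangle$ with $\phi([x_2,x_1])=[x_4,x_3]$; (iii) isomorphic to the amalgamated direct product \[\bigl(\langle x_1\rangle\amalg^{\mathfrak N_2}\langle x_2\rangle\bigr)\times_\phi\Bigl(\bigl(\langle x_3\rangle\amalg^{\mathfrak N_2}\langle x_4\rangle\amalg^{\mathfrak N_2}\langle x_5\rangle\bigr)/\langle[x_5,x_4]\rangle\Bigr),\] with each $x_i$ of order $p$, where $\phi$ is the embedding of $\langle[x_2,x_1]\rangle$ with $\phi([x_2,x_1])=[x_4,x_3]$ (the image of $[x_4,x_3]$ in the quotient); (iv) capable. -/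

import Mathlib

universe u v w

open scoped commutatorElement

theorem Subgroup.normal_of_subset_center {G : Type*} [Group G] {N : Subgroup G}
    (h : N ≤ Subgroup.center G) : N.Normal :=
  ⟨fun n hn g => by rwa [Subgroup.mem_center_iff.1 (h hn) g, mul_inv_cancel_right]⟩

/-- `G` is capable if it is isomorphic to the central quotient of some group. The universe of the
witnessing group is a free parameter. -/
def IsCapable (G : Type u) [Group G] : Prop :=
  ∃ (H : Type v) (_ : Group H), Nonempty (G ≃* H ⧸ Subgroup.center H)

/-- `G` is nilpotent of class at most `k`: the term `G_{k+1}` of the lower central series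
(`G_1 = G`, `G_{n+1} = [G_n, G]`) is trivial. Mathlib numbers the series from `0`. -/
def IsClassLE (k : ℕ) (G : Type u) [Group G] : Prop :=
  (⊤ : Subgroup G).lowerCentralSeries k = ⊥

/-- Extra-special `p`-groups: the center coincides with the commutator subgroup and has order `p`,
and the central quotient is elementary abelian. -/
structure IsExtraSpecial (p : ℕ) (E : Type u) [Group E] : Prop where
  isPGroup : IsPGroup p E
  card_center : Nat.card (Subgroup.center E) = p
  commutator_eq_center : commutator E = Subgroup.center E
  pow_mem_center : ∀ x : E, x ^ p ∈ Subgroup.center E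

/-- The `k`-nilpotent product `F / F_{k+1}` of the family `A`, where `F` is the free product. -/
abbrev NilpotentProduct (k : ℕ) {ι : Type u} (A : ι → Type v) [∀ i, Group (A i)] :=
  Monoid.CoprodI A ⧸ (⊤ : Subgroup (Monoid.CoprodI A)).lowerCentralSeries k

/-- The `2`-nilpotent product of `n` cyclic groups of order `p`. -/
abbrev NilCyclic (p n : ℕ) :=
  NilpotentProduct 2 (fun _ : Fin n => Multiplicative (ZMod p))

/-- The generator of the `i`-th cyclic factor. -/
def NilCyclic.gen (p n : ℕ) (i : Fin n) : NilCyclic p n :=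
  QuotientGroup.mk (Monoid.CoprodI.of (M := fun _ : Fin n => Multiplicative (ZMod p)) (i := i)
    (Multiplicative.ofAdd 1))

theorem NilCyclic.commutator_mem_center {p n : ℕ} (x y : NilCyclic p n) :
    ⁅x, y⁆ ∈ Subgroup.center (NilCyclic p n) := by
  obtain ⟨a, rfl⟩ := QuotientGroup.mk_surjective x
  obtain ⟨b, rfl⟩ := QuotientGroup.mk_surjective y
  rw [Subgroup.mem_center_iff]
  intro z
  obtain ⟨c, rfl⟩ := QuotientGroup.mk_surjective z
  symm
  rw [← commutatorElement_eq_one_iff_mul_comm]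
  refine (QuotientGroup.eq_one_iff ⁅⁅a, b⁆, c⁆).2 ?_
  exact Subgroup.commutator_mem_commutator
    (Subgroup.commutator_mem_commutator (Subgroup.mem_top a) (Subgroup.mem_top b))
    (Subgroup.mem_top c)

instance NilCyclic.zpowers_commutator_normal {p n : ℕ} (x y : NilCyclic p n) :
    (Subgroup.zpowers ⁅x, y⁆).Normal :=
  Subgroup.normal_of_subset_center
    (by simpa [Subgroup.zpowers_le] using NilCyclic.commutator_mem_center x y)

/-- The `2`-nilpotent product of three cyclic groups of order `p` with generators `y₀, y₁, y₂`,
modulo the (central) subgroup generated by `[y₂, y₁]`. -/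
abbrev NilCyclicThreeMod (p : ℕ) :=
  NilCyclic p 3 ⧸ Subgroup.zpowers ⁅NilCyclic.gen p 3 2, NilCyclic.gen p 3 1⁆

section Amalgam

variable {A : Type u} {B : Type v} [Group A] [Group B]

/-- For a subgroup `H` of `Z(A)` and `φ : H → Z(B)`, the subgroup `{(h, φ(h)⁻¹) | h ∈ H}` of
`A × B`. -/
def amalgamSubgroup (H : Subgroup (Subgroup.center A)) (φ : H →* Subgroup.center B) :
    Subgroup (A × B) where
  carrier := {z | ∃ h : H, z = (((h : Subgroup.center A) : A), (φ h : B)⁻¹)}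
  one_mem' := ⟨1, Prod.ext (by simp) (by simp)⟩
  mul_mem' := by
    rintro _ _ ⟨h, rfl⟩ ⟨k, rfl⟩
    refine ⟨h * k, Prod.ext (by simp) ?_⟩
    simpa using Subgroup.mem_center_iff.1 (inv_mem (φ k).2) _
  inv_mem' := by
    rintro _ ⟨h, rfl⟩
    exact ⟨h⁻¹, by simp⟩

instance amalgamSubgroup_normal (H : Subgroup (Subgroup.center A))
    (φ : H →* Subgroup.center B) : (amalgamSubgroup H φ).Normal := by
  apply Subgroup.normal_of_subset_center
  intro z hz
  obtain ⟨h, rfl⟩ := hz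
  rw [Subgroup.mem_center_iff]
  rintro ⟨a, b⟩
  exact Prod.ext (Subgroup.mem_center_iff.1 h.1.2 a)
    (Subgroup.mem_center_iff.1 (inv_mem (φ h).2) b)

/-- The amalgamated direct product `A ×_φ B = (A × B) / {(h, φ(h)⁻¹) | h ∈ H}`; it is used only
for injective `φ`. -/
abbrev AmalgamatedProduct (H : Subgroup (Subgroup.center A)) (φ : H →* Subgroup.center B) :=
  (A × B) ⧸ amalgamSubgroup H φ

/-- `G` is isomorphic to the amalgamated direct product `A ×_φ B`, where the embedding `φ` of the
cyclic subgroup `⟨a⟩ ≤ Z(A)` into `Z(B)` satisfies `φ(a) = b`. -/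
def IsAmalgam (G : Type*) [Group G] (a : A) (b : B) : Prop :=
  ∃ (H : Subgroup (Subgroup.center A)) (φ : H →* Subgroup.center B),
    H.map (Subgroup.center A).subtype = Subgroup.zpowers a ∧
    Function.Injective φ ∧
    (∃ h : H, ((h : Subgroup.center A) : A) = a ∧ (φ h : B) = b) ∧
    Nonempty (G ≃* AmalgamatedProduct H φ)

end Amalgam

/-- `G` is a direct product `E × C_p`. -/
def IsTypeI (p : ℕ) (E : Type v) [Group E] (G : Type u) [Group G] : Prop :=
  Nonempty (G ≃* E × Multiplicative (ZMod p))

/-- `G ≅ (⟨x₁⟩ ∐ ⟨x₂⟩) ×_φ (⟨x₃⟩ ∐ ⟨x₄⟩ ∐ ⟨x₅⟩)` with `2`-nilpotent products, each `xᵢ` of order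
`p`, and `φ([x₂, x₁]) = [x₄, x₃]`. Here `x₁, x₂` are the generators `0, 1` of the first factor and
`x₃, x₄, x₅` the generators `0, 1, 2` of the second one. The factors have class two, so that
`x y x⁻¹ y⁻¹ = x⁻¹ y⁻¹ x y` in them. -/
def IsTypeII (p : ℕ) (G : Type u) [Group G] : Prop :=
  IsAmalgam G
    ⁅NilCyclic.gen p 2 1, NilCyclic.gen p 2 0⁆
    ⁅NilCyclic.gen p 3 1, NilCyclic.gen p 3 0⁆

/-- `G ≅ (⟨x₁⟩ ∐ ⟨x₂⟩) ×_φ ((⟨x₃⟩ ∐ ⟨x₄⟩ ∐ ⟨x₅⟩) / ⟨[x₅, x₄]⟩)`, each `xᵢ` of order `p`, and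
`φ([x₂, x₁]) = [x₄, x₃]`. -/
def IsTypeIII (p : ℕ) (G : Type u) [Group G] : Prop :=
  IsAmalgam G
    ⁅NilCyclic.gen p 2 1, NilCyclic.gen p 2 0⁆
    (QuotientGroup.mk ⁅NilCyclic.gen p 3 1, NilCyclic.gen p 3 0⁆ :
      NilCyclicThreeMod p)

/-! Since p is odd, the Baer correspondence replaces G by an alternating bilinear map c : V × V → U
over the field F with p elements, whose values span U. The group is V × U with addition twisted by
c/2, the commutator is c, and dim V is the minimal number of generators, here 5.

Capability. A bilinear β : U × V → F is a Jacobi form if the cyclic sum of β(c(x, y), z) vanishes.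
It then defines a central extension of G by F in which lifts of u ∈ U and v ∈ V have commutator β(u,
v). Hence G is capable as soon as every nonzero u is detected by some Jacobi form (`exists_cochain`,
`BaerGroup.isCapable`). Otherwise there is a "rigid" u₀ ≠ 0, killed by all Jacobi forms.

Rigidity. For β = μ ⊗ g the cyclic sum is the trivector (μ ∘ c) ∧ g. Choose l with l(u₀) = 1 and put
ω = l ∘ c. If ω = f ∧ g, then l ⊗ f is a Jacobi form not killing u₀ unless f = 0; so ω is not
decomposable, has rank four, and its radical is a line ⟨e⟩. In symplectic coordinates, ω ∧ V*
consists of all trivectors in x₀, …, x₃ together with the multiples of ω ∧ x₄, modulo those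
trivectors. If β kills u₀ and its cyclic sum is ω ∧ f, then β - l ⊗ f is a Jacobi form, so f = 0
(`jac_eq_zero_of_rigid`). Suitable β show that μ ↦ μ(c(e, ·)) is injective on the functionals
killing u₀ (`eq_zero_of_contract_eq_zero`), and that its image, a subspace of a symplectic 4-space,
contains no two independent orthogonal elements (`proportional_of_isotropic`). The image is
therefore zero, a line or a hyperbolic plane, and c is equivalent to `mapOne`, `mapTwo` or
`mapThree` respectively (`classification`); their groups are the kinds (i), (iii), (ii).

Exclusiveness. In each of the three groups x₀, x₁ commute with x₂, x₃, x₄ and [x₀, x₁] = [x₂, x₃] ≠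
1. In a group with central quotient G, the lift of this element would commute with lifts of all
generators and so be central, a contradiction (`not_isCapable`). The three groups have orders p⁶,
p⁷, p⁸. -/

open Module

/-! ### Baer groups of alternating bilinear maps -/

/-- The Baer group of a bilinear map `c : V × V → U`: the set `V × U` with the multiplication
`(v, a) (w, b) = (v + w, a + b + c(v, w) / 2)`. -/
@[ext]
structure BaerGroup {F : Type*} {V : Type*} {U : Type*} [Field F] [AddCommGroup V] [Module F V]
    [AddCommGroup U] [Module F U] (c : V →ₗ[F] V →ₗ[F] U) where
  fst : V
  snd : U

namespace BaerGroup

section Basic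

variable {F V U : Type*} [Field F] [AddCommGroup V] [Module F V] [AddCommGroup U] [Module F U]
  {c : V →ₗ[F] V →ₗ[F] U}

instance : One (BaerGroup c) := ⟨⟨0, 0⟩⟩

instance : Mul (BaerGroup c) :=
  ⟨fun x y => ⟨x.fst + y.fst, x.snd + y.snd + (2⁻¹ : F) • c x.fst y.fst⟩⟩

instance : Inv (BaerGroup c) := ⟨fun x => ⟨-x.fst, -x.snd + (2⁻¹ : F) • c x.fst x.fst⟩⟩

@[simp] theorem one_fst : (1 : BaerGroup c).fst = 0 := rfl
@[simp] theorem one_snd : (1 : BaerGroup c).snd = 0 := rfl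
@[simp] theorem mul_fst (x y : BaerGroup c) : (x * y).fst = x.fst + y.fst := rfl
@[simp] theorem mul_snd (x y : BaerGroup c) :
    (x * y).snd = x.snd + y.snd + (2⁻¹ : F) • c x.fst y.fst := rfl
@[simp] theorem inv_fst (x : BaerGroup c) : (x⁻¹).fst = -x.fst := rfl
@[simp] theorem inv_snd (x : BaerGroup c) :
    (x⁻¹).snd = -x.snd + (2⁻¹ : F) • c x.fst x.fst := rfl

instance : Group (BaerGroup c) :=
  Group.ofLeftAxioms
    (fun x y z => by
      ext
      · simp [add_assoc]
      · simp only [mul_snd, mul_fst, map_add, LinearMap.add_apply, smul_add]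
        abel)
    (fun x => by ext <;> simp)
    (fun x => by ext <;> simp)

/-- A pair of linear equivalences compatible with the bilinear maps induces an isomorphism. -/
def congr {V' U' : Type*} [AddCommGroup V'] [Module F V'] [AddCommGroup U'] [Module F U']
    {c' : V' →ₗ[F] V' →ₗ[F] U'} (P : V ≃ₗ[F] V') (Q : U ≃ₗ[F] U')
    (h : ∀ x y, Q (c x y) = c' (P x) (P y)) : BaerGroup c ≃* BaerGroup c' where
  toFun x := ⟨P x.fst, Q x.snd⟩
  invFun x := ⟨P.symm x.fst, Q.symm x.snd⟩
  left_inv x := by ext <;> simp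
  right_inv x := by ext <;> simp
  map_mul' x y := by ext <;> simp [h]

/-- The Baer group is in bijection with the product of the two spaces. -/
def equivProd (c : V →ₗ[F] V →ₗ[F] U) : BaerGroup c ≃ V × U where
  toFun x := (x.fst, x.snd)
  invFun x := ⟨x.1, x.2⟩

theorem card_eq : Nat.card (BaerGroup c) = Nat.card V * Nat.card U := by
  rw [Nat.card_congr (equivProd c), Nat.card_prod]

theorem swap (hc : ∀ x, c x x = 0) (x y : V) : c y x = -c x y := by
  have h := hc (x + y)
  simp only [map_add, LinearMap.add_apply, hc, zero_add, add_zero] at h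
  exact eq_neg_of_add_eq_zero_left h

theorem pow_eq (hc : ∀ x, c x x = 0) (x : BaerGroup c) (n : ℕ) : x ^ n = ⟨n • x.fst, n • x.snd⟩ := by
  induction n with
  | zero => ext <;> simp
  | succ n ih => rw [pow_succ, ih]; ext <;> simp [hc, succ_nsmul]

theorem commutator_eq (hc : ∀ x, c x x = 0) (h2 : (2 : F) ≠ 0) (x y : BaerGroup c) :
    ⁅x, y⁆ = ⟨0, c x.fst y.fst⟩ := by
  have : x * y = ⟨0, c x.fst y.fst⟩ * (y * x) := by
    ext
    · simp [add_comm]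
    · simp only [mul_snd, mul_fst, map_zero, LinearMap.zero_apply, smul_zero, add_zero]
      rw [swap hc x.fst y.fst]
      have : c x.fst y.fst = (2⁻¹ : F) • c x.fst y.fst + (2⁻¹ : F) • c x.fst y.fst := by
        rw [← add_smul, ← two_mul, mul_inv_cancel₀ h2, one_smul]
      rw [smul_neg]
      nth_rewrite 2 [this]
      abel
  rw [commutatorElement_def, this]
  group

theorem commute_iff (hc : ∀ x, c x x = 0) (h2 : (2 : F) ≠ 0) (x y : BaerGroup c) :
    x * y = y * x ↔ c x.fst y.fst = 0 := by
  rw [← commutatorElement_eq_one_iff_mul_comm, commutator_eq hc h2]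
  constructor
  · intro h
    exact congrArg snd h
  · intro h
    ext <;> simp [h]

theorem commutator_comm (hc : ∀ x, c x x = 0) (h2 : (2 : F) ≠ 0) (x y z : BaerGroup c) :
    ⁅x, y⁆ * z = z * ⁅x, y⁆ := by
  rw [commutator_eq hc h2]
  ext <;> simp [add_comm]

end Basic

section ZMod

variable {p : ℕ} [Fact p.Prime] {V U : Type*} [AddCommGroup V] [Module (ZMod p) V]
  [AddCommGroup U] [Module (ZMod p) U] {c : V →ₗ[ZMod p] V →ₗ[ZMod p] U}

theorem pow_prime (hc : ∀ x, c x x = 0) (x : BaerGroup c) : x ^ p = 1 := by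
  rw [pow_eq hc]
  ext
  · simp [← Nat.cast_smul_eq_nsmul (ZMod p)]
  · simp [← Nat.cast_smul_eq_nsmul (ZMod p)]

theorem exponent_eq (hc : ∀ x, c x x = 0) [Nontrivial V] : Monoid.exponent (BaerGroup c) = p := by
  have h : Monoid.exponent (BaerGroup c) ∣ p :=
    Monoid.exponent_dvd_of_forall_pow_eq_one (pow_prime hc)
  rcases (Nat.dvd_prime Fact.out).1 h with h1 | h1
  · rw [Monoid.exp_eq_one_iff] at h1
    obtain ⟨x, hx⟩ := exists_ne (0 : V)
    exact absurd (congrArg fst (Subsingleton.elim (⟨x, 0⟩ : BaerGroup c) 1)) hx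
  · exact h1

/-- A subgroup containing `(b i, 0)` for a spanning family `b` is everything when the values of
`c` span `U`. -/
theorem eq_top_of_span (hc : ∀ x, c x x = 0) (h2 : (2 : ZMod p) ≠ 0) {ι : Type*} {b : ι → V}
    (hb : Submodule.span (ZMod p) (Set.range b) = ⊤)
    (hs : Submodule.span (ZMod p) (Set.range fun x : V × V => c x.1 x.2) = ⊤)
    (P : Subgroup (BaerGroup c)) (hP : ∀ i, (⟨b i, 0⟩ : BaerGroup c) ∈ P) : P = ⊤ := by
  let PU : AddSubgroup U :=
    { carrier := {u | (⟨0, u⟩ : BaerGroup c) ∈ P}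
      zero_mem' := P.one_mem
      add_mem' := fun {a b} ha hb => by
        have h : (⟨0, a + b⟩ : BaerGroup c) = ⟨0, a⟩ * ⟨0, b⟩ := by ext <;> simp
        exact (congrArg (· ∈ P) h).mpr (P.mul_mem ha hb)
      neg_mem' := fun {a} ha => by
        have h : (⟨0, -a⟩ : BaerGroup c) = (⟨0, a⟩)⁻¹ := by ext <;> simp
        exact (congrArg (· ∈ P) h).mpr (P.inv_mem ha) }
  let PV : AddSubgroup V :=
    { carrier := {v | ∃ u, (⟨v, u⟩ : BaerGroup c) ∈ P}
      zero_mem' := ⟨0, P.one_mem⟩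
      add_mem' := by
        rintro a b ⟨x, hx⟩ ⟨y, hy⟩
        exact ⟨_, P.mul_mem hx hy⟩
      neg_mem' := by
        rintro a ⟨x, hx⟩
        exact ⟨_, P.inv_mem hx⟩ }
  have hPV : AddSubgroup.toZModSubmodule p PV = ⊤ := by
    rw [eq_top_iff, ← hb, Submodule.span_le]
    rintro _ ⟨i, rfl⟩
    exact ⟨0, hP i⟩
  have hV : ∀ v, ∃ u, (⟨v, u⟩ : BaerGroup c) ∈ P := fun v => by
    have : v ∈ AddSubgroup.toZModSubmodule p PV := hPV ▸ Submodule.mem_top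
    exact this
  -- Commutators do not see the U-components, so arbitrary lifts of x and y to P already give (0,
  -- c(x, y)) ∈ P.
  have hPU : AddSubgroup.toZModSubmodule p PU = ⊤ := by
    rw [eq_top_iff, ← hs, Submodule.span_le]
    rintro _ ⟨⟨x, y⟩, rfl⟩
    obtain ⟨a, ha⟩ := hV x
    obtain ⟨b, hb⟩ := hV y
    have : ⁅(⟨x, a⟩ : BaerGroup c), ⟨y, b⟩⁆ ∈ P := by
      rw [commutatorElement_def]
      exact P.mul_mem (P.mul_mem (P.mul_mem ha hb) (P.inv_mem ha)) (P.inv_mem hb)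
    rwa [commutator_eq hc h2] at this
  rw [eq_top_iff]
  rintro ⟨v, u⟩ -
  obtain ⟨a, ha⟩ := hV v
  have hu : u - a ∈ AddSubgroup.toZModSubmodule p PU := hPU ▸ Submodule.mem_top
  have := P.mul_mem ha hu
  convert this using 1
  ext <;> simp

end ZMod

end BaerGroup

theorem ZMod.two_ne_zero_of_odd {p : ℕ} [Fact p.Prime] (h : Odd p) : (2 : ZMod p) ≠ 0 := by
  have := ZMod.natCast_eq_zero_iff 2 p
  rw [Nat.cast_ofNat] at this
  rw [Ne, this, Nat.dvd_prime Nat.prime_two]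
  obtain ⟨k, hk⟩ := h
  have := (Fact.out : p.Prime).two_le
  omega

/-! ### The Lie ring of a group of class two and odd exponent -/

/-- Groups of class at most two satisfying `x ^ p = 1`, with `p` odd. -/
class IsClassTwoExp (p : ℕ) (G : Type*) [Group G] : Prop where
  odd : Odd p
  comm : ∀ x y z : G, ⁅x, y⁆ * z = z * ⁅x, y⁆
  pow : ∀ x : G, x ^ p = 1

theorem isClassLE_two_iff {G : Type*} [Group G] :
    IsClassLE 2 G ↔ ∀ x y z : G, ⁅x, y⁆ * z = z * ⁅x, y⁆ := by
  have key : IsClassLE 2 G ↔ ⁅⁅(⊤ : Subgroup G), (⊤ : Subgroup G)⁆, (⊤ : Subgroup G)⁆ = ⊥ := Iff.rfl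
  rw [key, ← le_bot_iff, Subgroup.commutator_le]
  constructor
  · intro h x y z
    have := h ⁅x, y⁆ (Subgroup.commutator_mem_commutator (Subgroup.mem_top x) (Subgroup.mem_top y))
      z (Subgroup.mem_top z)
    rwa [Subgroup.mem_bot, commutatorElement_eq_one_iff_mul_comm] at this
  · intro h x hx y _
    have hle : ⁅(⊤ : Subgroup G), (⊤ : Subgroup G)⁆ ≤ Subgroup.center G := by
      rw [Subgroup.commutator_le]
      intro a _ b _
      exact Subgroup.mem_center_iff.2 fun g => (h a b g).symm
    rw [Subgroup.mem_bot, commutatorElement_eq_one_iff_mul_comm]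
    exact (Subgroup.mem_center_iff.1 (hle hx) y).symm

namespace IsClassTwoExp

section Comm

variable (p : ℕ) {G : Type*} [Group G]

/-- The square root of the commutator. -/
def halfComm (x y : G) : G := ⁅x, y⁆ ^ ((p + 1) / 2)

theorem halfComm_swap (x y : G) : halfComm p y x = (halfComm p x y)⁻¹ := by
  rw [halfComm, ← commutatorElement_inv, inv_pow]; rfl

theorem halfComm_of_comm {x y : G} (hxy : x * y = y * x) : halfComm p x y = 1 := by
  rw [halfComm, commutatorElement_eq_one_iff_mul_comm.2 hxy, one_pow]

/-- The additive operation of the Baer correspondence. -/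
def baerAdd (x y : G) : G := x * y * (halfComm p x y)⁻¹

theorem baerAdd_of_comm {x y : G} (hxy : x * y = y * x) : baerAdd p x y = x * y := by
  rw [baerAdd, halfComm_of_comm p hxy, inv_one, mul_one]

variable [h : IsClassTwoExp p G]

theorem commutator_mul_left (p : ℕ) {G : Type*} [Group G] [h : IsClassTwoExp p G] (x y z : G) :
    ⁅x * y, z⁆ = ⁅x, z⁆ * ⁅y, z⁆ := by
  have : ⁅x * y, z⁆ = x * ⁅y, z⁆ * x⁻¹ * ⁅x, z⁆ := by
    simp only [commutatorElement_def]; group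
  rw [this, ← h.comm y z x, mul_inv_cancel_right, h.comm]

theorem halfComm_comm (x y z : G) : halfComm p x y * z = z * halfComm p x y :=
  (Commute.pow_left (h.comm x y z) _ : Commute _ _)

theorem halfComm_mul_left (x y z : G) :
    halfComm p (x * y) z = halfComm p x z * halfComm p y z := by
  rw [halfComm, commutator_mul_left p, Commute.mul_pow (h.comm _ _ _)]; rfl

theorem halfComm_mul_right (x y z : G) :
    halfComm p x (y * z) = halfComm p x y * halfComm p x z := by
  rw [halfComm_swap, halfComm_mul_left p, mul_inv_rev, ← halfComm_swap, ← halfComm_swap,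
    halfComm_comm p]

/-- Oddness of p and the exponent enter here: twice (p + 1) / 2 is p + 1, and p-th powers are
trivial. -/
theorem halfComm_mul_self (x y : G) : halfComm p x y * halfComm p x y = ⁅x, y⁆ := by
  have : (p + 1) / 2 + (p + 1) / 2 = p + 1 := by
    obtain ⟨k, hk⟩ := h.odd
    omega
  rw [halfComm, ← pow_add, this, pow_succ, h.pow, one_mul]

theorem halfComm_inv_comm (x y z : G) : (halfComm p x y)⁻¹ * z = z * (halfComm p x y)⁻¹ :=
  (Commute.inv_left (halfComm_comm p x y z : Commute _ _) : Commute _ _)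

theorem halfComm_baerAdd_left (x y z : G) :
    halfComm p (baerAdd p x y) z = halfComm p x z * halfComm p y z := by
  rw [baerAdd, halfComm_mul_left p, halfComm_of_comm p (halfComm_inv_comm p x y z), mul_one,
    halfComm_mul_left p]

theorem halfComm_baerAdd_right (x y z : G) :
    halfComm p x (baerAdd p y z) = halfComm p x y * halfComm p x z := by
  rw [baerAdd, halfComm_mul_right p, halfComm_of_comm p (halfComm_inv_comm p y z x).symm, mul_one,
    halfComm_mul_right p]

theorem baerAdd_assoc (x y z : G) :
    baerAdd p (baerAdd p x y) z = baerAdd p x (baerAdd p y z) := by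
  have h1 : baerAdd p (baerAdd p x y) z
      = baerAdd p x y * z * (halfComm p x z * halfComm p y z)⁻¹ := by
    rw [← halfComm_baerAdd_left p]; rfl
  have h2 : baerAdd p x (baerAdd p y z)
      = x * baerAdd p y z * (halfComm p x y * halfComm p x z)⁻¹ := by
    rw [← halfComm_baerAdd_right p]; rfl
  rw [h1, h2, baerAdd, baerAdd]
  have a := halfComm_inv_comm p x y
  have b := halfComm_inv_comm p y z
  generalize (halfComm p x z) = t at *
  generalize hs : (halfComm p x y)⁻¹ = s at *
  generalize hr : (halfComm p y z)⁻¹ = r at *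
  rw [mul_inv_rev, mul_inv_rev, hs, hr]
  simp only [mul_assoc]
  rw [← mul_assoc s z, a z, mul_assoc, ← mul_assoc r t⁻¹ s, mul_assoc, ← a, ← mul_assoc s, a r,
    mul_assoc]

theorem baerAdd_comm (x y : G) : baerAdd p x y = baerAdd p y x := by
  have : x * y = halfComm p x y * halfComm p x y * (y * x) := by
    rw [halfComm_mul_self, commutatorElement_def]; group
  rw [baerAdd, baerAdd, halfComm_swap p x y, inv_inv, this, ← halfComm_comm p x y (y * x),
    mul_assoc (halfComm p x y), halfComm_comm p x y, mul_inv_cancel_right]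

end Comm

end IsClassTwoExp

/-- The underlying set of `G`, with the Lie ring structure of the Baer correspondence. -/
def BaerLie (_p : ℕ) (G : Type*) := G

namespace BaerLie

open IsClassTwoExp

section Lie

variable (p : ℕ) {G : Type*} [Group G]

/-- The identity map from `G` to its Lie ring. -/
def of : G ≃ BaerLie p G := Equiv.refl _

instance : Add (BaerLie p G) := ⟨fun x y => of p (baerAdd p ((of p).symm x) ((of p).symm y))⟩

instance : Zero (BaerLie p G) := ⟨of p 1⟩

instance : Neg (BaerLie p G) := ⟨fun x => of p ((of p).symm x)⁻¹⟩

theorem of_one : of p (1 : G) = 0 := rfl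

theorem of_add_of (x y : G) : of p x + of p y = of p (x * y * (halfComm p x y)⁻¹) := rfl

theorem of_mul_of_comm {x y : G} (hxy : x * y = y * x) : of p (x * y) = of p x + of p y :=
  (baerAdd_of_comm p hxy).symm

theorem of_inv (x : G) : of p x⁻¹ = -of p x := rfl

variable [h : IsClassTwoExp p G]

instance : AddCommGroup (BaerLie p G) where
  add_assoc x y z := baerAdd_assoc p ((of p).symm x) ((of p).symm y) ((of p).symm z)
  zero_add x := (baerAdd_of_comm p (show 1 * (of p).symm x = _ by simp)).trans (one_mul _)
  add_zero x := (baerAdd_of_comm p (show (of p).symm x * 1 = _ by simp)).trans (mul_one _)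
  neg_add_cancel x := (baerAdd_of_comm p (show ((of p).symm x)⁻¹ * (of p).symm x = _ by
    rw [inv_mul_cancel, mul_inv_cancel])).trans (inv_mul_cancel _)
  add_comm x y := baerAdd_comm p ((of p).symm x) ((of p).symm y)
  nsmul := nsmulRec
  zsmul := zsmulRec

theorem of_pow (x : G) (n : ℕ) : of p (x ^ n) = n • of p x := by
  induction n with
  | zero => rw [pow_zero, zero_nsmul]; rfl
  | succ n ih =>
    rw [pow_succ, of_mul_of_comm p (pow_mul_comm' x n), ih, succ_nsmul]

instance : Module (ZMod p) (BaerLie p G) :=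
  AddCommGroup.zmodModule fun x => by
    have := of_pow p ((of p).symm x : G) p
    rw [h.pow, of_one] at this
    simpa using this.symm

theorem of_commutator_add (x y z w : G) :
    of p (⁅x, y⁆ * ⁅z, w⁆) = of p ⁅x, y⁆ + of p ⁅z, w⁆ :=
  of_mul_of_comm p (h.comm x y _)

theorem commutator_add_left (x y z : G) :
    of p ⁅(of p).symm (of p x + of p y), z⁆ = of p ⁅x, z⁆ + of p ⁅y, z⁆ := by
  rw [of_add_of, Equiv.symm_apply_apply, commutator_mul_left p, commutator_mul_left p,
    commutatorElement_eq_one_iff_mul_comm.2 (halfComm_inv_comm p x y z), mul_one,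
    of_commutator_add]

/-- The Lie bracket, given by the group commutator. -/
def bracket : BaerLie p G →ₗ[ZMod p] BaerLie p G →ₗ[ZMod p] BaerLie p G :=
  AddMonoidHom.toZModLinearMap p <|
    AddMonoidHom.mk'
      (fun x => AddMonoidHom.toZModLinearMap p <|
        AddMonoidHom.mk' (fun y => of p ⁅(of p).symm x, (of p).symm y⁆) fun y z => by
          have e : ∀ w : BaerLie p G, of p ⁅(of p).symm x, (of p).symm w⁆
              = -of p ⁅(of p).symm w, (of p).symm x⁆ := fun w => by
            rw [← of_inv, commutatorElement_inv]
          rw [e, e, e, ← neg_add]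
          exact congrArg _ (commutator_add_left p (G := G) _ _ _))
      fun x y => LinearMap.ext fun z => commutator_add_left p (G := G) _ _ _

theorem bracket_of (x y : G) : bracket p (of p x) (of p y) = of p ⁅x, y⁆ := rfl

theorem bracket_self (x : BaerLie p G) : bracket p x x = 0 := by
  obtain ⟨x, rfl⟩ := (of p (G := G)).surjective x
  rw [bracket_of, commutatorElement_self, of_one]

theorem bracket_bracket (x y z : BaerLie p G) : bracket p (bracket p x y) z = 0 := by
  obtain ⟨x, rfl⟩ := (of p (G := G)).surjective x
  obtain ⟨y, rfl⟩ := (of p (G := G)).surjective y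
  obtain ⟨z, rfl⟩ := (of p (G := G)).surjective z
  rw [bracket_of, bracket_of, commutatorElement_eq_one_iff_mul_comm.2 (h.comm x y z), of_one]

theorem bracket_swap (x y : BaerLie p G) : bracket p y x = -bracket p x y := by
  have h := bracket_self p (x + y)
  simp only [map_add, LinearMap.add_apply, bracket_self, zero_add, add_zero] at h
  exact eq_neg_of_add_eq_zero_left h

theorem of_mul [Fact p.Prime] (x y : G) :
    of p (x * y) = of p x + of p y + (2⁻¹ : ZMod p) • bracket p (of p x) (of p y) := by
  have h2 := ZMod.two_ne_zero_of_odd h.odd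
  have e1 : of p (x * y) = of p x + of p y + of p (halfComm p x y) := by
    rw [of_add_of, ← of_mul_of_comm p (halfComm_comm p x y _).symm, inv_mul_cancel_right]
  have e2 : (2 : ZMod p) • of p (halfComm p x y) = bracket p (of p x) (of p y) := by
    rw [bracket_of, ← halfComm_mul_self p, of_mul_of_comm p rfl, two_smul]
  rw [e1, ← e2, inv_smul_smul₀ h2]

end Lie

end BaerLie

theorem BaerGroup.isClassTwoExp {p : ℕ} [Fact p.Prime] (hodd : Odd p) {V U : Type*}
    [AddCommGroup V] [Module (ZMod p) V] [AddCommGroup U] [Module (ZMod p) U]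
    {c : V →ₗ[ZMod p] V →ₗ[ZMod p] U} (hc : ∀ x, c x x = 0) : IsClassTwoExp p (BaerGroup c) :=
  ⟨hodd, commutator_comm hc (ZMod.two_ne_zero_of_odd hodd), pow_prime hc⟩

/-! ### The Baer correspondence in coordinates -/

namespace BaerLie

variable (p : ℕ) [Fact p.Prime] {G : Type*} [Group G] [h : IsClassTwoExp p G]

/-- Linear maps compatible with the brackets induce a homomorphism from the Baer group. -/
def lift {V U : Type*} [AddCommGroup V] [Module (ZMod p) V] [AddCommGroup U] [Module (ZMod p) U]
    {c : V →ₗ[ZMod p] V →ₗ[ZMod p] U} (f : V →ₗ[ZMod p] BaerLie p G)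
    (g : U →ₗ[ZMod p] BaerLie p G) (hg : ∀ u x, bracket p (g u) x = 0)
    (hfg : ∀ v w, g (c v w) = bracket p (f v) (f w)) : BaerGroup c →* G :=
  MonoidHom.mk' (fun x => (of p).symm (f x.fst + g x.snd)) fun x y => by
    apply (of p).injective
    rw [of_mul]
    have hg' : ∀ u x, bracket p x (g u) = 0 := fun u x => by
      rw [bracket_swap, hg, neg_zero]
    simp only [Equiv.apply_symm_apply, BaerGroup.mul_fst, BaerGroup.mul_snd, map_add, hg, hg',
      LinearMap.add_apply, add_zero, map_smul, hfg]
    abel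

theorem of_lift {V U : Type*} [AddCommGroup V] [Module (ZMod p) V] [AddCommGroup U]
    [Module (ZMod p) U] {c : V →ₗ[ZMod p] V →ₗ[ZMod p] U} (f : V →ₗ[ZMod p] BaerLie p G)
    (g : U →ₗ[ZMod p] BaerLie p G) (hg : ∀ u x, bracket p (g u) x = 0)
    (hfg : ∀ v w, g (c v w) = bracket p (f v) (f w)) (x : BaerGroup c) :
    of p (lift p f g hg hfg x) = f x.fst + g x.snd := rfl

variable (G) in
/-- The derived subalgebra of the Lie ring. -/
def derived : Submodule (ZMod p) (BaerLie p G) :=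
  Submodule.span (ZMod p) (Set.range fun x : BaerLie p G × BaerLie p G => bracket p x.1 x.2)

theorem bracket_mem_derived (x y : BaerLie p G) : bracket p x y ∈ derived p G :=
  Submodule.subset_span ⟨(x, y), rfl⟩

theorem bracket_eq_zero_of_mem_derived {x : BaerLie p G} (hx : x ∈ derived p G)
    (y : BaerLie p G) : bracket p x y = 0 := by
  have : derived p G ≤ LinearMap.ker (bracket p (G := G)) := by
    rw [derived, Submodule.span_le]
    rintro _ ⟨⟨a, b⟩, rfl⟩
    exact LinearMap.ext fun z => bracket_bracket p a b z
  exact congrArg (· y) (this hx)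

/-- The bracket on a submodule, with values in the derived subalgebra. -/
def bracketOn (W : Submodule (ZMod p) (BaerLie p G)) : W →ₗ[ZMod p] W →ₗ[ZMod p] derived p G :=
  LinearMap.mk₂ (ZMod p) (fun x y => ⟨bracket p (x : BaerLie p G) y, bracket_mem_derived p _ _⟩)
    (fun _ _ _ => Subtype.ext (by simp)) (fun _ _ _ => Subtype.ext (by simp))
    (fun _ _ _ => Subtype.ext (by simp)) (fun _ _ _ => Subtype.ext (by simp))

@[simp] theorem coe_bracketOn (W : Submodule (ZMod p) (BaerLie p G)) (x y : W) :
    (bracketOn p W x y : BaerLie p G) = bracket p (x : BaerLie p G) y := rfl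

theorem bracketOn_self (W : Submodule (ZMod p) (BaerLie p G)) (x : W) :
    bracketOn p W x x = 0 := Subtype.ext (bracket_self p _)

/-- The derived subalgebra is central, so the bracket depends only on the components in a
complement. -/
theorem bracket_eq_of_isCompl {W : Submodule (ZMod p) (BaerLie p G)}
    (hW : IsCompl (derived p G) W) (x y : BaerLie p G) :
    ∃ a b : W, bracket p x y = bracket p (a : BaerLie p G) b := by
  have hx : ∀ x : BaerLie p G, ∃ d ∈ derived p G, ∃ w ∈ W, d + w = x := fun x =>
    Submodule.mem_sup.1 (hW.sup_eq_top ▸ Submodule.mem_top)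
  obtain ⟨d, hd, a, ha, rfl⟩ := hx x
  obtain ⟨e, he, b, hb, rfl⟩ := hx y
  refine ⟨⟨a, ha⟩, ⟨b, hb⟩, ?_⟩
  rw [LinearMap.map_add₂, bracket_eq_zero_of_mem_derived p hd, zero_add, map_add,
    bracket_swap p e a, bracket_eq_zero_of_mem_derived p he, neg_zero, zero_add]

theorem span_bracketOn {W : Submodule (ZMod p) (BaerLie p G)} (hW : IsCompl (derived p G) W) :
    Submodule.span (ZMod p) (Set.range fun x : W × W => bracketOn p W x.1 x.2) = ⊤ := by
  apply Submodule.map_injective_of_injective (derived p G).injective_subtype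
  rw [Submodule.map_span, Submodule.map_top, Submodule.range_subtype]
  conv_rhs => rw [derived]
  congr 1
  ext z
  constructor
  · rintro ⟨_, ⟨⟨a, b⟩, rfl⟩, rfl⟩
    exact ⟨(a, b), rfl⟩
  · rintro ⟨⟨x, y⟩, rfl⟩
    obtain ⟨a, b, hab⟩ := bracket_eq_of_isCompl p hW x y
    exact ⟨_, ⟨(a, b), rfl⟩, hab.symm⟩

/-- The Baer correspondence: `G` is the Baer group of its bracket on a complement of the derived
subalgebra. -/
theorem nonempty_equiv {W : Submodule (ZMod p) (BaerLie p G)} (hW : IsCompl (derived p G) W) :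
    Nonempty (G ≃* BaerGroup (bracketOn p W)) := by
  let φ : BaerGroup (bracketOn p W) →* G :=
    lift p W.subtype (derived p G).subtype (fun u x => bracket_eq_zero_of_mem_derived p u.2 x)
      fun v w => rfl
  refine ⟨(MulEquiv.ofBijective φ ⟨?_, ?_⟩).symm⟩
  · rw [injective_iff_map_eq_one]
    intro x hx
    have h1 : (x.fst : BaerLie p G) + x.snd = 0 := congrArg (of p) hx
    have h2 : (x.fst : BaerLie p G) ∈ derived p G := by
      rw [eq_neg_of_add_eq_zero_left h1]
      exact neg_mem x.snd.2
    have h3 : (x.fst : BaerLie p G) = 0 :=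
      Submodule.disjoint_def.1 hW.disjoint _ h2 x.fst.2
    rw [h3, zero_add] at h1
    exact BaerGroup.ext (Subtype.ext h3) (Subtype.ext h1)
  · intro g
    obtain ⟨d, hd, a, ha, hda⟩ : ∃ d ∈ derived p G, ∃ w ∈ W, d + w = of p g :=
      Submodule.mem_sup.1 (hW.sup_eq_top ▸ Submodule.mem_top)
    refine ⟨⟨⟨a, ha⟩, ⟨d, hd⟩⟩, (of p).injective ?_⟩
    rw [← hda, add_comm]
    exact of_lift p _ _ _ _ _

theorem mkQ_of_mul (x y : G) : (derived p G).mkQ (of p (x * y))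
    = (derived p G).mkQ (of p x) + (derived p G).mkQ (of p y) := by
  rw [of_mul, map_add, map_add, map_smul]
  have : (derived p G).mkQ (bracket p (of p x) (of p y)) = 0 :=
    (Submodule.Quotient.mk_eq_zero _).2 (bracket_mem_derived p _ _)
  rw [this, smul_zero, add_zero]

theorem span_mkQ_of_closure {S : Set G} (hS : Subgroup.closure S = ⊤) :
    Submodule.span (ZMod p) ((fun x => (derived p G).mkQ (of p x)) '' S) = ⊤ := by
  rw [eq_top_iff]
  rintro x -
  obtain ⟨y, rfl⟩ := (derived p G).mkQ_surjective x
  obtain ⟨g, rfl⟩ := (of p (G := G)).surjective y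
  have hg : g ∈ Subgroup.closure S := hS ▸ Subgroup.mem_top g
  induction hg using Subgroup.closure_induction with
  | mem x hx => exact Submodule.subset_span ⟨x, hx, rfl⟩
  | one => rw [of_one, map_zero]; exact zero_mem _
  | mul x y _ _ hx hy => rw [mkQ_of_mul]; exact add_mem hx hy
  | inv x _ hx => rw [of_inv, map_neg]; exact neg_mem hx

/-- A finitely generated group of class at most two and exponent `p` is a Baer group on coordinate
spaces; the dimension of the first one is the number of generators. -/
theorem exists_coordinates [Group.FG G] :
    ∃ (d : ℕ) (c : (Fin (Group.rank G) → ZMod p) →ₗ[ZMod p] (Fin (Group.rank G) → ZMod p)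
        →ₗ[ZMod p] (Fin d → ZMod p)),
      (∀ x, c x x = 0) ∧
      Submodule.span (ZMod p) (Set.range fun x :
        (Fin (Group.rank G) → ZMod p) × (Fin (Group.rank G) → ZMod p) => c x.1 x.2) = ⊤ ∧
      Nonempty (G ≃* BaerGroup c) := by
  obtain ⟨W, hW⟩ := (derived p G).exists_isCompl
  obtain ⟨S, hSc, hS⟩ := Group.rank_spec G
  have hspan := span_mkQ_of_closure p hS
  have hfin : Module.Finite (ZMod p) (BaerLie p G ⧸ derived p G) :=
    ⟨Submodule.fg_def.2 ⟨_, S.finite_toSet.image _, hspan⟩⟩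
  -- Modulo the derived subalgebra the group product is addition, so generators of the group span
  -- the quotient.
  have hle : Module.finrank (ZMod p) (BaerLie p G ⧸ derived p G) ≤ Group.rank G := by
    classical
    rw [← hSc, ← finrank_top, ← hspan, ← Finset.coe_image]
    exact (finrank_span_finset_le_card _).trans Finset.card_image_le
  have e := Submodule.quotientEquivOfIsCompl _ _ hW
  have hWfin : Module.Finite (ZMod p) W := Module.Finite.equiv e
  rw [e.finrank_eq] at hle
  have hWF : Finite W := Module.finite_of_finite (ZMod p)
  have hspan' := span_bracketOn p hW
  have hDfin : Module.Finite (ZMod p) (derived p G) :=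
    ⟨Submodule.fg_def.2 ⟨_, Set.finite_range _, hspan'⟩⟩
  obtain ⟨φ⟩ := nonempty_equiv p hW
  have h2 := ZMod.two_ne_zero_of_odd h.odd
  -- Conversely, a basis of the complement generates the group, because commutators fill the derived
  -- part.
  have hge : Group.rank G ≤ Module.finrank (ZMod p) W := by
    classical
    let b := Module.finBasis (ZMod p) W
    let T : Finset (BaerGroup (bracketOn p W)) := Finset.univ.image fun i => ⟨b i, 0⟩
    have hT : Subgroup.closure (T : Set (BaerGroup (bracketOn p W))) = ⊤ :=
      BaerGroup.eq_top_of_span (bracketOn_self p W) h2 b.span_eq hspan' _ fun i =>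
        Subgroup.subset_closure (by simp [T])
    have : Group.FG (BaerGroup (bracketOn p W)) := ⟨⟨T, hT⟩⟩
    rw [Group.rank_congr φ]
    exact (Group.rank_le hT).trans (Finset.card_image_le.trans (by simp))
  have hn : Module.finrank (ZMod p) W = Group.rank G := le_antisymm hle hge
  let P : W ≃ₗ[ZMod p] (Fin (Group.rank G) → ZMod p) :=
    (Module.finBasisOfFinrankEq (ZMod p) W hn).equivFun
  let Q := (Module.finBasis (ZMod p) (derived p G)).equivFun
  let c := ((bracketOn p W).compl₁₂ P.symm.toLinearMap P.symm.toLinearMap).compr₂ Q.toLinearMap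
  have hcP : ∀ x y, Q (bracketOn p W x y) = c (P x) (P y) := fun x y => by simp [c]
  refine ⟨_, c, fun x => ?_, ?_, ⟨φ.trans (BaerGroup.congr P Q hcP)⟩⟩
  · simp [c, bracketOn_self]
  · have := congrArg (Submodule.map Q.toLinearMap) hspan'
    rw [Submodule.map_span, Submodule.map_top, LinearEquiv.range, ← Set.range_comp] at this
    rw [eq_top_iff, ← this]
    apply Submodule.span_mono
    rintro _ ⟨⟨x, y⟩, rfl⟩
    exact ⟨(P x, P y), (hcP x y).symm⟩

end BaerLie

/-! ### Capability from central extensions -/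

theorem isCapable_of_ker {G : Type u} [Group G] {K : Type v} [Group K] (π : K →* G)
    (hπ : Function.Surjective π) (hk : π.ker = Subgroup.center K) : IsCapable.{u, v} G :=
  ⟨K, inferInstance, ⟨((QuotientGroup.quotientMulEquivOfEq hk.symm).trans
    (QuotientGroup.quotientKerEquivOfSurjective π hπ)).symm⟩⟩

theorem IsCapable.of_equiv {G : Type u} [Group G] {G' : Type w} [Group G'] (e : G ≃* G')
    (h : IsCapable.{w, v} G') : IsCapable.{u, v} G := by
  obtain ⟨K, _, ⟨φ⟩⟩ := h
  exact ⟨K, inferInstance, ⟨e.trans φ⟩⟩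

/-- The central extension of `H` by `Z` defined by a function `f : H × H → Z`. -/
@[ext]
structure CocycleExtension {H Z : Type*} (f : H → H → Z) where
  fst : H
  snd : Z

namespace CocycleExtension

variable {H Z : Type*} [Group H] [AddCommGroup Z] {f : H → H → Z}

/-- The group structure given by a normalized 2-cocycle. -/
abbrev group (h1 : ∀ x, f 1 x = 0) (hf : ∀ x y z, f x y + f (x * y) z = f y z + f x (y * z)) :
    Group (CocycleExtension f) :=
  letI : One (CocycleExtension f) := ⟨⟨1, 0⟩⟩
  letI : Mul (CocycleExtension f) := ⟨fun x y => ⟨x.fst * y.fst, x.snd + y.snd + f x.fst y.fst⟩⟩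
  letI : Inv (CocycleExtension f) := ⟨fun x => ⟨x.fst⁻¹, -x.snd - f x.fst⁻¹ x.fst⟩⟩
  Group.ofLeftAxioms
    (fun x y z => CocycleExtension.ext (mul_assoc _ _ _) <| by
      change x.snd + y.snd + f x.fst y.fst + z.snd + f (x.fst * y.fst) z.fst
        = x.snd + (y.snd + z.snd + f y.fst z.fst) + f x.fst (y.fst * z.fst)
      rw [eq_sub_of_add_eq (hf x.fst y.fst z.fst)]
      abel)
    (fun x => CocycleExtension.ext (one_mul _) <| by
      change 0 + x.snd + f 1 x.fst = x.snd
      rw [h1, zero_add, add_zero])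
    (fun x => CocycleExtension.ext (inv_mul_cancel _) <| by
      change -x.snd - f x.fst⁻¹ x.fst + x.snd + f x.fst⁻¹ x.fst = 0
      abel)

end CocycleExtension

/-- A group is capable if it has a normalized 2-cocycle such that in the corresponding extension
no nontrivial element lifts to the center. -/
theorem isCapable_of_cocycle {H Z : Type} [Group H] [AddCommGroup Z] (f : H → H → Z)
    (h1 : ∀ x, f 1 x = 0) (h1' : ∀ x, f x 1 = 0)
    (hf : ∀ x y z, f x y + f (x * y) z = f y z + f x (y * z))
    (hn : ∀ x, (∀ y, x * y = y * x ∧ f x y = f y x) → x = 1) : IsCapable.{0, v} H := by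
  let _ := CocycleExtension.group h1 hf
  let π : CocycleExtension f →* H := MonoidHom.mk' CocycleExtension.fst fun x y => rfl
  -- The lift only serves to place the extension in the prescribed universe.
  let φ : ULift.{v} (CocycleExtension f) →* H := π.comp MulEquiv.ulift.toMonoidHom
  refine isCapable_of_ker φ (fun x => ⟨⟨⟨x, 0⟩⟩, rfl⟩) ?_
  ext ⟨x⟩
  rw [MonoidHom.mem_ker, Subgroup.mem_center_iff]
  constructor
  · rintro hx ⟨y⟩
    have hx' : x.fst = 1 := hx
    refine ULift.ext _ _ (CocycleExtension.ext ?_ ?_)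
    · change y.fst * x.fst = x.fst * y.fst
      rw [hx', one_mul, mul_one]
    · change y.snd + x.snd + f y.fst x.fst = x.snd + y.snd + f x.fst y.fst
      rw [hx', h1, h1', add_comm y.snd]
  · intro hx
    refine hn x.fst fun y => ?_
    have h := congrArg ULift.down (hx ⟨⟨y, 0⟩⟩)
    refine ⟨(congrArg CocycleExtension.fst h).symm, ?_⟩
    have h2 : 0 + x.snd + f y x.fst = x.snd + 0 + f x.fst y := congrArg CocycleExtension.snd h
    rw [zero_add, add_zero] at h2
    exact (add_left_cancel h2).symm

section Jacobi

variable {F V U : Type*} [Field F] [AddCommGroup V] [Module F V] [AddCommGroup U] [Module F U]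

/-- The Jacobi identity for a bilinear form `β : U × V → F` relative to `c : V × V → U`. -/
def IsJacobi (c : V →ₗ[F] V →ₗ[F] U) (β : U →ₗ[F] V →ₗ[F] F) : Prop :=
  ∀ x y z, β (c x y) z + β (c y z) x + β (c z x) y = 0

end Jacobi

section Cochain

variable {F : Type*} [Field F] {n : ℕ} {U : Type*} [AddCommGroup U] [Module F U]

/-- The trilinear form on `Fⁿ` with given coefficients. -/
def triForm (B : Fin n → Fin n → Fin n → F) (x y z : Fin n → F) : F :=
  ∑ i, ∑ j, ∑ k, x i * y j * z k * B i j k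

variable (B : Fin n → Fin n → Fin n → F)

theorem triForm_add_left (x x' y z : Fin n → F) :
    triForm B (x + x') y z = triForm B x y z + triForm B x' y z := by
  simp only [triForm, Pi.add_apply, add_mul, Finset.sum_add_distrib]

theorem triForm_add_mid (x y y' z : Fin n → F) :
    triForm B x (y + y') z = triForm B x y z + triForm B x y' z := by
  simp only [triForm, Pi.add_apply, mul_add, add_mul, Finset.sum_add_distrib]

theorem triForm_add_right (x y z z' : Fin n → F) :
    triForm B x y (z + z') = triForm B x y z + triForm B x y z' := by
  simp only [triForm, Pi.add_apply, mul_add, add_mul, Finset.sum_add_distrib]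

theorem triForm_swap_right (hB : ∀ i j k, B i j k = B i k j) (x y z : Fin n → F) :
    triForm B x y z = triForm B x z y := by
  simp only [triForm]
  refine Finset.sum_congr rfl fun i _ => ?_
  rw [Finset.sum_comm]
  refine Finset.sum_congr rfl fun j _ => Finset.sum_congr rfl fun k _ => ?_
  rw [hB i j k]
  ring

theorem triForm_sub_swap_left (x y z : Fin n → F) :
    triForm B x y z - triForm B y x z = triForm (fun i j k => B i j k - B j i k) x y z := by
  have : triForm B y x z = triForm (fun i j k => B j i k) x y z := by
    simp only [triForm]
    rw [Finset.sum_comm]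
    refine Finset.sum_congr rfl fun i _ => Finset.sum_congr rfl fun j _ =>
      Finset.sum_congr rfl fun k _ => ?_
    ring
  rw [this]
  simp only [triForm, mul_sub, Finset.sum_sub_distrib]

theorem apply_apply_eq_triForm (c : (Fin n → F) →ₗ[F] (Fin n → F) →ₗ[F] U)
    (β : U →ₗ[F] (Fin n → F) →ₗ[F] F) (x y z : Fin n → F) :
    β (c x y) z = triForm (fun i j k =>
      β (c (Pi.single i 1) (Pi.single j 1)) (Pi.single k 1)) x y z := by
  have e : ∀ (φ : (Fin n → F) →ₗ[F] F) (v : Fin n → F), φ v = ∑ i, v i * φ (Pi.single i 1) :=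
    fun φ v => by
      conv_lhs => rw [← (Pi.basisFun F (Fin n)).sum_repr v]
      simp
  rw [triForm]
  have e1 := e ((β.flip z).comp (c.flip y)) x
  simp only [LinearMap.comp_apply, LinearMap.flip_apply] at e1
  rw [e1]
  refine Finset.sum_congr rfl fun i _ => ?_
  have e2 := e ((β.flip z).comp (c (Pi.single i 1))) y
  simp only [LinearMap.comp_apply, LinearMap.flip_apply] at e2
  rw [e2, Finset.mul_sum]
  refine Finset.sum_congr rfl fun j _ => ?_
  rw [e (β _) z, Finset.mul_sum, Finset.mul_sum]
  refine Finset.sum_congr rfl fun k _ => ?_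
  ring

/-- For a form satisfying the Jacobi identity, `β(c(v, w), z) / 2` is the coboundary of a
normalized cochain. -/
theorem exists_cochain {c : (Fin n → F) →ₗ[F] (Fin n → F) →ₗ[F] U}
    (hc : ∀ x, c x x = 0) {β : U →ₗ[F] (Fin n → F) →ₗ[F] F} (hβ : IsJacobi c β) :
    ∃ g : (Fin n → F) → (Fin n → F) → F, (∀ x, g 0 x = 0) ∧ (∀ x, g x 0 = 0) ∧
      ∀ x y z, 2⁻¹ * β (c x y) z = g y z + g x (y + z) - g x y - g (x + y) z := by
  let D : Fin n → Fin n → Fin n → F := fun i j k =>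
    β (c (Pi.single i 1) (Pi.single j 1)) (Pi.single k 1)
  have hDs : ∀ i j k, D i j k = -D j i k := fun i j k => by
    simp only [D]
    rw [BaerGroup.swap hc, map_neg, LinearMap.neg_apply]
  have hD0 : ∀ i k, D i i k = 0 := fun i k => by simp [D, hc]
  have hDJ : ∀ i j k, D i j k + D j k i + D k i j = 0 := fun i j k => hβ _ _ _
  -- The Jacobi identity makes D the antisymmetrization in i, j of some B symmetric in j, k. The
  -- averaged choice (D i j k + D i k j) / 3 would exclude characteristic 3; this one, which keeps D
  -- only where min j k ≤ i, involves no division.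
  let B : Fin n → Fin n → Fin n → F := fun i j k =>
    if j ≤ k then (if j ≤ i then D i j k else 0) else (if k ≤ i then D i k j else 0)
  have hBs : ∀ i j k, B i j k = B i k j := fun i j k => by
    simp only [B]
    rcases lt_trichotomy j k with h | rfl | h
    · rw [if_pos h.le, if_neg h.not_ge]
    · rfl
    · rw [if_neg h.not_ge, if_pos h.le]
  have hBD : ∀ i j k, B i j k - B j i k = D i j k := fun i j k => by
    simp only [B]
    have h1 := hDs i j k
    have h2 := hDs j k i
    have h3 := hDs k i j
    have h4 := hDJ i j k
    grind
  have hT : ∀ x y z, triForm B x y z - triForm B y x z = β (c x y) z := fun x y z => by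
    rw [triForm_sub_swap_left, apply_apply_eq_triForm]
    simp only [hBD, D]
  -- In the coboundary of T(x, x, y) + T(x, y, y) all terms with a repeated argument cancel; by
  -- symmetry in the last two arguments T(x, y, z) - T(y, x, z) remains.
  refine ⟨fun x y => 2⁻¹ * (triForm B x x y + triForm B x y y), fun x => ?_, fun x => ?_,
    fun x y z => ?_⟩
  · simp [triForm]
  · simp [triForm]
  · rw [← hT]
    simp only [triForm_add_left, triForm_add_mid, triForm_add_right]
    rw [triForm_swap_right B hBs x z y]
    ring

end Cochain

/-- If every nonzero `u` is detected by a form satisfying the Jacobi identity, then the Baer group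
is capable. -/
theorem BaerGroup.isCapable {F : Type} [Field F] {n : ℕ} (hn : 2 ≤ n) {U : Type} [AddCommGroup U]
    [Module F U] {c : (Fin n → F) →ₗ[F] (Fin n → F) →ₗ[F] U}
    (hc : ∀ x, c x x = 0)
    (h : ∀ u, (∀ β : U →ₗ[F] (Fin n → F) →ₗ[F] F, IsJacobi c β → β u = 0) → u = 0) :
    IsCapable.{0, v} (BaerGroup c) := by
  have hg : ∀ β : {β : U →ₗ[F] (Fin n → F) →ₗ[F] F // IsJacobi c β}, _ := fun β =>
    exists_cochain hc β.2
  choose g hg0 hg0' hg using hg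
  -- The first component uses all Jacobi forms at once, corrected by g to satisfy the cocycle
  -- condition. The second, all products xᵢyⱼ, forces central elements to have trivial V-part even
  -- when c has a radical.
  let f : BaerGroup c → BaerGroup c →
      ({β : U →ₗ[F] (Fin n → F) →ₗ[F] F // IsJacobi c β} → F) × (Fin n → Fin n → F) :=
    fun x y => (fun β => β.1 x.snd y.fst + g β x.fst y.fst, fun i j => x.fst i * y.fst j)
  refine isCapable_of_cocycle f (fun x => ?_) (fun x => ?_) (fun x y z => ?_) (fun x hx => ?_)
  · refine Prod.ext (funext fun β => ?_) (funext fun i => funext fun j => ?_)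
    · simp [f, hg0]
    · simp [f]
  · refine Prod.ext (funext fun β => ?_) (funext fun i => funext fun j => ?_)
    · simp [f, hg0']
    · simp [f]
  · refine Prod.ext (funext fun β => ?_) (funext fun i => funext fun j => ?_)
    · have := hg β x.fst y.fst z.fst
      simp only [f, Prod.fst_add, Pi.add_apply, mul_fst, mul_snd, map_add, LinearMap.add_apply,
        map_smul, LinearMap.smul_apply, smul_eq_mul]
      linear_combination this
    · simp only [f, Prod.snd_add, Pi.add_apply, mul_fst]
      ring
  · have hx1 : x.fst = 0 := by
      by_contra hne
      obtain ⟨i, hi⟩ := Function.ne_iff.1 hne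
      -- A second coordinate j ≠ i is needed: against the basis vector eⱼ the (i, j) entry is xᵢ in
      -- one order and 0 in the other.
      have : Nontrivial (Fin n) := Fin.nontrivial_iff_two_le.2 hn
      obtain ⟨j, hj⟩ := exists_ne i
      have := congrFun (congrFun (congrArg Prod.snd (hx ⟨Pi.single j 1, 0⟩).2) i) j
      simp [f, hj.symm] at this
      exact hi this
    refine BaerGroup.ext hx1 (h _ fun β hβ => LinearMap.ext fun w => ?_)
    have := congrFun (congrArg Prod.fst (hx ⟨w, 0⟩).2) ⟨β, hβ⟩
    simpa [f, hx1, hg0, hg0'] using this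

/-! ### The Jacobi sum as an alternating trilinear form -/

section Jacobi

variable {F V U : Type*} [Field F] [AddCommGroup V] [Module F V] [AddCommGroup U] [Module F U]

/-- The cyclic sum whose vanishing is the Jacobi identity. -/
def jac (c : V →ₗ[F] V →ₗ[F] U) (β : U →ₗ[F] V →ₗ[F] F) (x y z : V) : F :=
  β (c x y) z + β (c y z) x + β (c z x) y

variable {c : V →ₗ[F] V →ₗ[F] U} {β : U →ₗ[F] V →ₗ[F] F}

theorem jac_cycle (x y z : V) : jac c β x y z = jac c β y z x := by
  simp only [jac]; ring

theorem jac_swap (hc : ∀ x, c x x = 0) (x y z : V) : jac c β y x z = -jac c β x y z := by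
  simp only [jac]
  rw [BaerGroup.swap hc x y, BaerGroup.swap hc z x, BaerGroup.swap hc y z]
  simp only [map_neg, LinearMap.neg_apply]
  ring

theorem jac_eq_zero_of_basis_left {ι : Type*} (b : Basis ι F V) {y z : V}
    (h : ∀ i, jac c β (b i) y z = 0) (x : V) : jac c β x y z = 0 := by
  have : (β.flip z).comp (c.flip y) + β (c y z) + (β.flip y).comp (c z) = 0 :=
    b.ext fun i => by simpa [jac] using h i
  simpa [jac] using congrArg (fun f : V →ₗ[F] F => f x) this

/-- The cyclic sum is trilinear and alternating, hence determined by increasing triples of basis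
vectors. -/
theorem isJacobi_of_basis {ι : Type*} [LinearOrder ι] (hc : ∀ x, c x x = 0) (b : Basis ι F V)
    (h : ∀ i j k, i < j → j < k → jac c β (b i) (b j) (b k) = 0) : IsJacobi c β := by
  have h0 : ∀ i k, jac c β (b i) (b i) (b k) = 0 := fun i k => by
    simp only [jac]
    rw [hc, BaerGroup.swap hc (b k) (b i)]
    simp
  have h3 : ∀ i j k, jac c β (b i) (b j) (b k) = 0 := by
    intro i j k
    rcases lt_trichotomy i j with hij | rfl | hij
    · rcases lt_trichotomy j k with hjk | rfl | hjk
      · exact h i j k hij hjk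
      · rw [jac_cycle, h0]
      · rcases lt_trichotomy i k with hik | rfl | hik
        · rw [← neg_eq_zero, ← jac_swap hc, jac_cycle, h i k j hik hjk]
        · rw [jac_cycle, jac_cycle, h0]
        · rw [jac_cycle, jac_cycle, h k i j hik hij]
    · exact h0 i k
    · rcases lt_trichotomy i k with hik | rfl | hik
      · rw [← neg_eq_zero, ← jac_swap hc, h j i k hij hik]
      · rw [jac_cycle, jac_cycle, h0]
      · rcases lt_trichotomy j k with hjk | rfl | hjk
        · rw [jac_cycle, h j k i hjk hik]
        · rw [jac_cycle, h0]
        · rw [← neg_eq_zero, ← jac_swap hc, jac_cycle, jac_cycle, h k j i hjk hij]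
  intro x y z
  change jac c β x y z = 0
  refine jac_eq_zero_of_basis_left b (fun i => ?_) x
  rw [jac_cycle]
  refine jac_eq_zero_of_basis_left b (fun j => ?_) y
  rw [jac_cycle]
  refine jac_eq_zero_of_basis_left b (fun k => ?_) z
  rw [jac_cycle]
  exact h3 i j k

end Jacobi

/-! ### Symplectic quadruples and bases -/

section Symplectic

variable {F V : Type*} [Field F] [AddCommGroup V] [Module F V]

/-- A symplectic quadruple for a bilinear form. -/
structure IsSymplecticQuadruple (ω : V →ₗ[F] V →ₗ[F] F) (v : Fin 4 → V) : Prop where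
  h01 : ω (v 0) (v 1) = 1
  h02 : ω (v 0) (v 2) = 0
  h03 : ω (v 0) (v 3) = 0
  h12 : ω (v 1) (v 2) = 0
  h13 : ω (v 1) (v 3) = 0
  h23 : ω (v 2) (v 3) = 1

/-- A hyperbolic pair extends to a symplectic quadruple unless the form is decomposable. -/
theorem exists_isSymplecticQuadruple {ω : V →ₗ[F] V →ₗ[F] F} (hω : ∀ x, ω x x = 0)
    (hdec : ¬ ∃ f g : V →ₗ[F] F, ∀ x y, ω x y = f x * g y - f y * g x) {v₀ v₁ : V}
    (h01 : ω v₀ v₁ = 1) :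
    ∃ v : Fin 4 → V, v 0 = v₀ ∧ v 1 = v₁ ∧ IsSymplecticQuadruple ω v := by
  have sw := BaerGroup.swap hω
  -- This is the projection onto the orthogonal complement of the hyperbolic pair along its span. If
  -- ω vanished on that complement, ω would be ω(·, v₁) ∧ ω(v₀, ·).
  let q : V → V := fun x => x - ω x v₁ • v₀ + ω x v₀ • v₁
  have h10 : ω v₁ v₀ = -1 := by rw [sw, h01]
  have hq : ∀ x, ω v₀ (q x) = 0 ∧ ω v₁ (q x) = 0 := fun x => by
    simp only [q, map_add, map_sub, map_smul, hω, h01, h10, smul_eq_mul]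
    rw [sw x v₀, sw x v₁]
    constructor <;> ring
  obtain ⟨x, y, hxy⟩ : ∃ x y, ω (q x) (q y) ≠ 0 := by
    by_contra hne
    push Not at hne
    refine hdec ⟨ω.flip v₁, ω v₀, fun x y => ?_⟩
    have := hne x y
    have h2 := hq y
    have h3 : ω x (q y) = 0 := by
      have e : ω (q x) (q y) = ω x (q y) - ω x v₁ * ω v₀ (q y) + ω x v₀ * ω v₁ (q y) := by
        simp [q]
      rw [this, h2.1, h2.2] at e
      simpa using e.symm
    simp only [q, map_add, map_sub, map_smul, smul_eq_mul] at h3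
    simp only [LinearMap.flip_apply]
    rw [sw x v₀]
    rw [sw v₀ y] at h3
    linear_combination h3
  refine ⟨![v₀, v₁, (ω (q x) (q y))⁻¹ • q x, q y], rfl, rfl, ?_⟩
  constructor <;> simp [h01, hq, hxy]

namespace IsSymplecticQuadruple

variable {ω : V →ₗ[F] V →ₗ[F] F} {v : Fin 4 → V}

/-- Pairing the relation with each vector of the quadruple isolates, up to sign, the coefficient of
its hyperbolic partner. -/
theorem eq_zero_of_sum (hω : ∀ x, ω x x = 0) (h : IsSymplecticQuadruple ω v) {a : Fin 4 → F}
    {e : V} (he : ∀ i, ω (v i) e = 0) (ha : ∑ i, a i • v i + e = 0) : ∀ i, a i = 0 := by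
  have sw := BaerGroup.swap hω
  have key : ∀ i, ω (v i) (∑ i, a i • v i + e) = 0 := fun i => by rw [ha, map_zero]
  simp only [Fin.sum_univ_four, map_add, map_smul, smul_eq_mul, he, add_zero] at key
  have h10 := sw (v 0) (v 1)
  have h20 := sw (v 0) (v 2)
  have h30 := sw (v 0) (v 3)
  have h21 := sw (v 1) (v 2)
  have h31 := sw (v 1) (v 3)
  have h32 := sw (v 2) (v 3)
  have k0 := key 0
  have k1 := key 1
  have k2 := key 2
  have k3 := key 3
  simp only [h10, h20, h30, h21, h31, h32, h.h01, h.h02, h.h03, h.h12, h.h13, h.h23, hω]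
    at k0 k1 k2 k3
  intro i
  fin_cases i
  · simpa using k1
  · simpa using k0
  · simpa using k3
  · simpa using k2

theorem linearIndependent (hω : ∀ x, ω x x = 0) (h : IsSymplecticQuadruple ω v) :
    LinearIndependent F v := by
  rw [Fintype.linearIndependent_iff]
  intro a ha
  exact h.eq_zero_of_sum hω (e := 0) (fun i => map_zero _) (by rw [ha, add_zero])

end IsSymplecticQuadruple

/-- A basis of a five-dimensional space adapted to an alternating form of rank four. -/
structure IsSymplecticBasis (ω : V →ₗ[F] V →ₗ[F] F) (b : Basis (Fin 5) F V) : Prop where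
  h01 : ω (b 0) (b 1) = 1
  h02 : ω (b 0) (b 2) = 0
  h03 : ω (b 0) (b 3) = 0
  h12 : ω (b 1) (b 2) = 0
  h13 : ω (b 1) (b 3) = 0
  h23 : ω (b 2) (b 3) = 1
  h4 : ω (b 4) = 0

theorem IsSymplecticQuadruple.exists_basis {ω : V →ₗ[F] V →ₗ[F] F} {v : Fin 4 → V}
    (hω : ∀ x, ω x x = 0) (h : IsSymplecticQuadruple ω v) (hV : finrank F V = 5) {e : V}
    (he0 : e ≠ 0) (he : ∀ i, ω (v i) e = 0) :
    ∃ b : Basis (Fin 5) F V, b 0 = v 0 ∧ b 1 = v 1 ∧ b 4 = e ∧ IsSymplecticBasis ω b := by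
  let w : Fin 5 → V := ![v 0, v 1, v 2, v 3, e]
  have hw : LinearIndependent F w := by
    rw [Fintype.linearIndependent_iff]
    intro a ha
    have ha' : ∑ i : Fin 4, (![a 0, a 1, a 2, a 3] : Fin 4 → F) i • v i + a 4 • e = 0 := by
      rw [← ha, Fin.sum_univ_five, Fin.sum_univ_four]
      rfl
    have h0 := h.eq_zero_of_sum hω (fun i => by rw [map_smul, he, smul_zero]) ha'
    have a0 : a 0 = 0 := h0 0
    have a1 : a 1 = 0 := h0 1
    have a2 : a 2 = 0 := h0 2
    have a3 : a 3 = 0 := h0 3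
    have a4 : a 4 = 0 := by
      have : a 4 • e = 0 := by
        rw [Fin.sum_univ_five, a0, a1, a2, a3] at ha
        simp only [zero_smul, zero_add] at ha
        exact ha
      exact (smul_eq_zero.1 this).resolve_right he0
    intro i
    fin_cases i <;> assumption
  let b := basisOfLinearIndependentOfCardEqFinrank hw (by simp [hV])
  have hb : ∀ i, b i = w i := fun i => by simp [b]
  refine ⟨b, hb 0, hb 1, hb 4, ?_⟩
  have b0 : b 0 = v 0 := hb 0
  have b1 : b 1 = v 1 := hb 1
  have b2 : b 2 = v 2 := hb 2
  have b3 : b 3 = v 3 := hb 3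
  have b4 : b 4 = e := hb 4
  refine ⟨by rw [b0, b1, h.h01], by rw [b0, b2, h.h02], by rw [b0, b3, h.h03],
    by rw [b1, b2, h.h12], by rw [b1, b3, h.h13], by rw [b2, b3, h.h23], ?_⟩
  refine b.ext fun i => ?_
  rw [b4]
  fin_cases i
  · change ω e (b 0) = 0; rw [b0, BaerGroup.swap hω, he, neg_zero]
  · change ω e (b 1) = 0; rw [b1, BaerGroup.swap hω, he, neg_zero]
  · change ω e (b 2) = 0; rw [b2, BaerGroup.swap hω, he, neg_zero]
  · change ω e (b 3) = 0; rw [b3, BaerGroup.swap hω, he, neg_zero]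
  · change ω e (b 4) = 0; rw [b4, hω]

theorem exists_ne_zero_of_card_lt_finrank {n : ℕ} (f : Fin n → V →ₗ[F] F)
    (hV : n < finrank F V) : ∃ e : V, e ≠ 0 ∧ ∀ i, f i e = 0 := by
  have : FiniteDimensional F V := FiniteDimensional.of_finrank_pos (by omega)
  have hker : LinearMap.ker (LinearMap.pi f) ≠ ⊥ :=
    LinearMap.ker_ne_bot_of_finrank_lt (by simpa using hV)
  obtain ⟨e, he, hne⟩ := Submodule.exists_mem_ne_zero_of_ne_bot hker
  exact ⟨e, hne, fun i => congrFun he i⟩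

/-- Expansion of an alternating form in coordinates. -/
theorem alternating_expand {θ : V →ₗ[F] V →ₗ[F] F} (hθ : ∀ x, θ x x = 0) (b : Basis (Fin 5) F V)
    (x y : V) : θ x y =
      θ (b 0) (b 1) * (b.coord 0 x * b.coord 1 y - b.coord 1 x * b.coord 0 y)
      + θ (b 0) (b 2) * (b.coord 0 x * b.coord 2 y - b.coord 2 x * b.coord 0 y)
      + θ (b 0) (b 3) * (b.coord 0 x * b.coord 3 y - b.coord 3 x * b.coord 0 y)
      + θ (b 0) (b 4) * (b.coord 0 x * b.coord 4 y - b.coord 4 x * b.coord 0 y)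
      + θ (b 1) (b 2) * (b.coord 1 x * b.coord 2 y - b.coord 2 x * b.coord 1 y)
      + θ (b 1) (b 3) * (b.coord 1 x * b.coord 3 y - b.coord 3 x * b.coord 1 y)
      + θ (b 1) (b 4) * (b.coord 1 x * b.coord 4 y - b.coord 4 x * b.coord 1 y)
      + θ (b 2) (b 3) * (b.coord 2 x * b.coord 3 y - b.coord 3 x * b.coord 2 y)
      + θ (b 2) (b 4) * (b.coord 2 x * b.coord 4 y - b.coord 4 x * b.coord 2 y)
      + θ (b 3) (b 4) * (b.coord 3 x * b.coord 4 y - b.coord 4 x * b.coord 3 y) := by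
  have sw := BaerGroup.swap hθ
  have hx := b.sum_repr x
  have hy := b.sum_repr y
  rw [Fin.sum_univ_five] at hx hy
  conv_lhs => rw [← hx, ← hy]
  simp only [map_add, map_smul, LinearMap.add_apply, LinearMap.smul_apply, smul_eq_mul,
    Basis.coord_apply, hθ]
  rw [sw (b 0) (b 1), sw (b 0) (b 2), sw (b 0) (b 3), sw (b 0) (b 4), sw (b 1) (b 2),
    sw (b 1) (b 3), sw (b 1) (b 4), sw (b 2) (b 3), sw (b 2) (b 4), sw (b 3) (b 4)]
  ring

end Symplectic

/-! ### Consequences of rigidity -/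

section Rigid

variable {F V U : Type*} [Field F] [AddCommGroup V] [Module F V] [AddCommGroup U] [Module F U]
  {c : V →ₗ[F] V →ₗ[F] U} {u₀ : U}

/-- The bilinear form `(u, v) ↦ μ(u) g(v)`. -/
def tensorForm (μ : U →ₗ[F] F) (g : V →ₗ[F] F) : U →ₗ[F] V →ₗ[F] F := μ.smulRight g

@[simp] theorem tensorForm_apply (μ : U →ₗ[F] F) (g : V →ₗ[F] F) (u : U) (v : V) :
    tensorForm μ g u v = μ u * g v := by simp [tensorForm]

/-- If l ∘ c = f ∧ g, then l ⊗ f is a Jacobi form because f ∧ g ∧ f = 0. Rigidity and l(u₀) = 1 then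
give f = 0, so l ∘ c = 0. -/
theorem not_decomposable_of_rigid {l : U →ₗ[F] F}
    (hu : ∀ β, IsJacobi c β → β u₀ = 0) (hl : l u₀ = 1) {v₀ v₁ : V} (h01 : l (c v₀ v₁) ≠ 0) :
    ¬ ∃ f g : V →ₗ[F] F, ∀ x y, c.compr₂ l x y = f x * g y - f y * g x := by
  rintro ⟨f, g, hfg⟩
  simp only [LinearMap.compr₂_apply] at hfg
  have hf : f = 0 := by
    have := hu (tensorForm l f) fun x y z => by
      simp only [tensorForm_apply, hfg]
      ring
    ext v
    simpa [hl] using congrArg (fun h : V →ₗ[F] F => h v) this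
  rw [hfg, hf] at h01
  simp at h01

/-- If l ∘ c = 0, every l ⊗ f is a Jacobi form, and l ⊗ f does not kill u₀ for f ≠ 0. -/
theorem exists_ne_zero_of_rigid [Nontrivial V] {l : U →ₗ[F] F}
    (hu : ∀ β, IsJacobi c β → β u₀ = 0) (hl : l u₀ = 1) : ∃ x y, l (c x y) ≠ 0 := by
  by_contra hne
  push Not at hne
  obtain ⟨v, hv⟩ := exists_ne (0 : V)
  obtain ⟨f, hf⟩ : ∃ f : V →ₗ[F] F, f v ≠ 0 := by
    by_contra hf
    push Not at hf
    exact hv ((Module.forall_dual_apply_eq_zero_iff F v).1 hf)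
  have := hu (tensorForm l f) fun x y z => by simp [hne]
  have h2 : tensorForm l f u₀ v = 0 := by rw [this]; rfl
  rw [tensorForm_apply, hl, one_mul] at h2
  exact hf h2

variable {l : U →ₗ[F] F} {b : Basis (Fin 5) F V}

/-- If `ω = x₀ ∧ x₁ + x₂ ∧ x₃`, the trivectors without the last index are of the form `ω ∧ f`, and
rigidity forbids a nontrivial relation. -/
theorem jac_eq_zero_of_rigid (hc : ∀ x, c x x = 0) (hu : ∀ β, IsJacobi c β → β u₀ = 0)
    (hl : l u₀ = 1) (hb : IsSymplecticBasis (c.compr₂ l) b) {β : U →ₗ[F] V →ₗ[F] F}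
    (hβ : β u₀ = 0) {t : F}
    (h01 : jac c β (b 0) (b 1) (b 4) = t) (h02 : jac c β (b 0) (b 2) (b 4) = 0)
    (h03 : jac c β (b 0) (b 3) (b 4) = 0) (h12 : jac c β (b 1) (b 2) (b 4) = 0)
    (h13 : jac c β (b 1) (b 3) (b 4) = 0) (h23 : jac c β (b 2) (b 3) (b 4) = t) :
    t = 0 ∧ jac c β (b 0) (b 1) (b 2) = 0 ∧ jac c β (b 0) (b 1) (b 3) = 0 ∧
      jac c β (b 0) (b 2) (b 3) = 0 ∧ jac c β (b 1) (b 2) (b 3) = 0 := by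
  -- With ω = x₀ ∧ x₁ + x₂ ∧ x₃, these are the coefficients of the f for which ω ∧ f equals the
  -- cyclic sum of β.
  let f : V →ₗ[F] F := b.constr F ![jac c β (b 0) (b 2) (b 3), jac c β (b 1) (b 2) (b 3),
    jac c β (b 0) (b 1) (b 2), jac c β (b 0) (b 1) (b 3), t]
  have f0 : f (b 0) = jac c β (b 0) (b 2) (b 3) := b.constr_basis F _ 0
  have f1 : f (b 1) = jac c β (b 1) (b 2) (b 3) := b.constr_basis F _ 1
  have f2 : f (b 2) = jac c β (b 0) (b 1) (b 2) := b.constr_basis F _ 2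
  have f3 : f (b 3) = jac c β (b 0) (b 1) (b 3) := b.constr_basis F _ 3
  have f4 : f (b 4) = t := b.constr_basis F _ 4
  have sw : ∀ x y, l (c y x) = -l (c x y) := fun x y => by rw [BaerGroup.swap hc, map_neg]
  have hJ : IsJacobi c (β - tensorForm l f) := by
    have e : ∀ x y z, jac c (β - tensorForm l f) x y z
        = jac c β x y z - (l (c x y) * f z + l (c y z) * f x - l (c x z) * f y) := fun x y z => by
      rw [sub_eq_add_neg (l (c x y) * f z + _), ← neg_mul, ← sw]
      simp only [jac, LinearMap.sub_apply, tensorForm_apply]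
      ring
    have w01 : l (c (b 0) (b 1)) = 1 := hb.h01
    have w02 : l (c (b 0) (b 2)) = 0 := hb.h02
    have w03 : l (c (b 0) (b 3)) = 0 := hb.h03
    have w12 : l (c (b 1) (b 2)) = 0 := hb.h12
    have w13 : l (c (b 1) (b 3)) = 0 := hb.h13
    have w23 : l (c (b 2) (b 3)) = 1 := hb.h23
    have w4 : ∀ x, l (c x (b 4)) = 0 := fun x => by
      have : l (c (b 4) x) = 0 := congrArg (fun h : V →ₗ[F] F => h x) hb.h4
      rw [sw, this, neg_zero]
    refine isJacobi_of_basis hc b fun i j k hij hjk => ?_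
    have hcases : (i, j, k) ∈ ({(0, 1, 2), (0, 1, 3), (0, 1, 4), (0, 2, 3), (0, 2, 4), (0, 3, 4),
        (1, 2, 3), (1, 2, 4), (1, 3, 4), (2, 3, 4)} : Finset (Fin 5 × Fin 5 × Fin 5)) := by
      revert i j k
      decide
    simp only [Finset.mem_insert, Finset.mem_singleton, Prod.mk.injEq] at hcases
    rw [e]
    rcases hcases with ⟨rfl, rfl, rfl⟩ | ⟨rfl, rfl, rfl⟩ | ⟨rfl, rfl, rfl⟩ | ⟨rfl, rfl, rfl⟩ |
      ⟨rfl, rfl, rfl⟩ | ⟨rfl, rfl, rfl⟩ | ⟨rfl, rfl, rfl⟩ | ⟨rfl, rfl, rfl⟩ | ⟨rfl, rfl, rfl⟩ |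
      ⟨rfl, rfl, rfl⟩ <;>
    simp [w01, w02, w03, w12, w13, w23, w4, f0, f1, f2, f3, f4, h01, h02, h03, h12, h13, h23]
  -- As β kills u₀, the Jacobi form β - l ⊗ f takes u₀ to -f.
  have hf : ∀ x, f x = 0 := fun x => by
    have := congrArg (fun h : V →ₗ[F] F => h x) (hu _ hJ)
    simpa [hβ, hl] using this
  exact ⟨by rw [← f4, hf], by rw [← f2, hf], by rw [← f3, hf], by rw [← f0, hf], by rw [← f1, hf]⟩

/-- The functional `x ↦ μ(c(e, x))`. -/
def contract (c : V →ₗ[F] V →ₗ[F] U) (e : V) (μ : U →ₗ[F] F) : V →ₗ[F] F := μ.comp (c e)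

@[simp] theorem contract_apply (e : V) (μ : U →ₗ[F] F) (x : V) :
    contract c e μ x = μ (c e x) := rfl

/-- A functional vanishing on the values of `c` on a basis is zero. -/
theorem eq_zero_of_basis_values (hc : ∀ x, c x x = 0)
    (hs : Submodule.span F (Set.range fun x : V × V => c x.1 x.2) = ⊤) {μ : U →ₗ[F] F}
    (b : Basis (Fin 5) F V)
    (h01 : μ (c (b 0) (b 1)) = 0) (h02 : μ (c (b 0) (b 2)) = 0) (h03 : μ (c (b 0) (b 3)) = 0)
    (h04 : μ (c (b 0) (b 4)) = 0) (h12 : μ (c (b 1) (b 2)) = 0) (h13 : μ (c (b 1) (b 3)) = 0)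
    (h14 : μ (c (b 1) (b 4)) = 0) (h23 : μ (c (b 2) (b 3)) = 0) (h24 : μ (c (b 2) (b 4)) = 0)
    (h34 : μ (c (b 3) (b 4)) = 0) : μ = 0 := by
  refine LinearMap.ext_on_range hs fun x => ?_
  have := alternating_expand (θ := c.compr₂ μ) (fun x => by simp [hc]) b x.1 x.2
  simpa only [LinearMap.compr₂_apply, h01, h02, h03, h04, h12, h13, h14, h23, h24, h34, zero_mul,
    add_zero, LinearMap.zero_apply] using this

/-- Under the hypotheses μ ∘ c is a 2-form in x₀, …, x₃ only. For i ≤ 3 the trivectors (μ ∘ c) ∧ xᵢ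
do not involve x₄, so rigidity makes them vanish, and i = 0, 1, 2 already give all six coefficients.
-/
theorem eq_zero_of_contract_eq_zero (hc : ∀ x, c x x = 0)
    (hs : Submodule.span F (Set.range fun x : V × V => c x.1 x.2) = ⊤)
    (hu : ∀ β, IsJacobi c β → β u₀ = 0)
    (hl : l u₀ = 1) (hb : IsSymplecticBasis (c.compr₂ l) b) {μ : U →ₗ[F] F} (hμ : μ u₀ = 0)
    (h : contract c (b 4) μ = 0) : μ = 0 := by
  have h4 : ∀ x, μ (c (b 4) x) = 0 := fun x => congrArg (fun f : V →ₗ[F] F => f x) h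
  have sw : ∀ x y, μ (c y x) = -μ (c x y) := fun x y => by rw [BaerGroup.swap hc, map_neg]
  have h4' : ∀ x, μ (c x (b 4)) = 0 := fun x => by rw [sw, h4, neg_zero]
  have key : ∀ i : Fin 5, i ≠ 4 → _ := fun i hi =>
    jac_eq_zero_of_rigid hc hu hl hb (β := tensorForm μ (b.coord i)) (t := 0)
      (LinearMap.ext fun x => by simp [hμ])
      (by simp [jac, h4, h4', hi.symm]) (by simp [jac, h4, h4', hi.symm])
      (by simp [jac, h4, h4', hi.symm]) (by simp [jac, h4, h4', hi.symm])
      (by simp [jac, h4, h4', hi.symm]) (by simp [jac, h4, h4', hi.symm])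
  obtain ⟨-, a1, a2, a3, -⟩ := key 0 (by decide)
  obtain ⟨-, a4, a5, -, -⟩ := key 1 (by decide)
  obtain ⟨-, a6, -, -, -⟩ := key 2 (by decide)
  simp [jac] at a1 a2 a3 a4 a5 a6
  exact eq_zero_of_basis_values hc hs b a6 (by rw [sw, a4, neg_zero]) (by rw [sw, a5, neg_zero])
    (h4' _) a1 a2 (h4' _) a3 (h4' _) (h4' _)

/-- The form is nondegenerate on the span of the first four basis vectors, and the fifth lies in the
radical; the witness is the usual symplectic dual. -/
theorem IsSymplecticBasis.exists_dual {ω : V →ₗ[F] V →ₗ[F] F} (hω : ∀ x, ω x x = 0)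
    (hb : IsSymplecticBasis ω b) {s : V →ₗ[F] F} (hs : s (b 4) = 0) : ∃ v, ω v = s := by
  have sw := BaerGroup.swap hω
  refine ⟨s (b 1) • b 0 - s (b 0) • b 1 + s (b 3) • b 2 - s (b 2) • b 3, b.ext fun i => ?_⟩
  have h4 : ∀ x, ω x (b 4) = 0 := fun x => by rw [sw, hb.h4]; simp
  have h10 := sw (b 0) (b 1)
  have h20 := sw (b 0) (b 2)
  have h30 := sw (b 0) (b 3)
  have h21 := sw (b 1) (b 2)
  have h31 := sw (b 1) (b 3)
  have h32 := sw (b 2) (b 3)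
  simp only [map_add, map_sub, map_smul, LinearMap.add_apply, LinearMap.sub_apply,
    LinearMap.smul_apply, smul_eq_mul]
  fin_cases i <;>
    simp [h10, h20, h30, h21, h31, h32, hb.h01, hb.h02, hb.h03, hb.h12, hb.h13, hb.h23, hω, h4, hs]

/-- A hyperbolic pair and a nonzero radical vector extend to a symplectic basis. -/
theorem exists_symplecticBasis_of_rigid (hc : ∀ x, c x x = 0) (hV : finrank F V = 5)
    (hu : ∀ β, IsJacobi c β → β u₀ = 0) (hl : l u₀ = 1) {e v₀ v₁ : V} (he0 : e ≠ 0)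
    (he : ∀ x, l (c x e) = 0) (h01 : l (c v₀ v₁) = 1) :
    ∃ b : Basis (Fin 5) F V, b 0 = v₀ ∧ b 1 = v₁ ∧ b 4 = e ∧
      IsSymplecticBasis (c.compr₂ l) b := by
  have hω : ∀ x, c.compr₂ l x x = 0 := fun x => by simp [hc]
  obtain ⟨v, rfl, rfl, hv⟩ := exists_isSymplecticQuadruple hω
    (not_decomposable_of_rigid hu hl (by rw [h01]; exact one_ne_zero)) h01
  exact hv.exists_basis hω hV he0 fun i => he _

/-- Rigidity yields a symplectic quadruple; the fifth vector solves four linear conditions in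
dimension five. -/
theorem exists_symplecticBasis (hc : ∀ x, c x x = 0) (hV : finrank F V = 5)
    (hu : ∀ β, IsJacobi c β → β u₀ = 0) (hl : l u₀ = 1) :
    ∃ b : Basis (Fin 5) F V, IsSymplecticBasis (c.compr₂ l) b := by
  have : Nontrivial V := nontrivial_of_finrank_pos (R := F) (by omega)
  have hω : ∀ x, c.compr₂ l x x = 0 := fun x => by simp [hc]
  obtain ⟨x, y, hxy⟩ := exists_ne_zero_of_rigid hu hl
  obtain ⟨v, -, -, hv⟩ := exists_isSymplecticQuadruple hω
    (not_decomposable_of_rigid hu hl hxy) (v₀ := (l (c x y))⁻¹ • x) (v₁ := y) (by simp [hxy])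
  obtain ⟨e, he0, he⟩ := exists_ne_zero_of_card_lt_finrank (fun i => c.compr₂ l (v i))
    (by omega)
  obtain ⟨b, -, -, -, hb⟩ := hv.exists_basis hω hV he0 he
  exact ⟨b, hb⟩

/-- Functionals orthogonal for the symplectic form are proportional. -/
theorem proportional_of_isotropic (hc : ∀ x, c x x = 0)
    (hs : Submodule.span F (Set.range fun x : V × V => c x.1 x.2) = ⊤) (hV : finrank F V = 5)
    (hu : ∀ β, IsJacobi c β → β u₀ = 0) (hl : l u₀ = 1)
    (hb : IsSymplecticBasis (c.compr₂ l) b) {μ ν : U →ₗ[F] F} (hμ : μ u₀ = 0) (hν : ν u₀ = 0)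
    (hμ0 : μ ≠ 0) {v w : V} (hv : c.compr₂ l v = contract c (b 4) μ)
    (hw : c.compr₂ l w = contract c (b 4) ν) (hvw : l (c v w) = 0) : ∃ a : F, ν = a • μ := by
  by_contra hne
  push Not at hne
  have hinj : ∀ a : F, contract c (b 4) ν ≠ a • contract c (b 4) μ := fun a ha => by
    refine hne a (sub_eq_zero.1 (eq_zero_of_contract_eq_zero hc hs hu hl hb
      (by simp [hμ, hν]) ?_))
    ext x
    have := congrArg (fun f : V →ₗ[F] F => f x) ha
    simp only [contract_apply, LinearMap.smul_apply] at this
    simp [this]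
  have hμ1 : contract c (b 4) μ ≠ 0 := fun h =>
    hμ0 (eq_zero_of_contract_eq_zero hc hs hu hl hb hμ h)
  -- The two contractions are linearly independent functionals, so they can be prescribed at one
  -- vector.
  obtain ⟨z, hz1, hz2⟩ : ∃ z, contract c (b 4) μ z = 1 ∧ contract c (b 4) ν z = 0 := by
    generalize contract c (b 4) μ = s at *
    generalize contract c (b 4) ν = s' at *
    have hs' : s' ≠ 0 := fun h => hinj 0 (by rw [h, zero_smul])
    obtain ⟨y, hy⟩ : ∃ y, s' y ≠ 0 := by
      by_contra h
      push Not at h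
      exact hs' (LinearMap.ext h)
    obtain ⟨x, hx⟩ : ∃ x, s x ≠ s y / s' y * s' x := by
      by_contra h
      push Not at h
      by_cases hsy : s y = 0
      · exact hμ1 (LinearMap.ext fun x => by rw [h, hsy]; simp)
      · refine hinj (s' y / s y) (LinearMap.ext fun x => ?_)
        have hx := h x
        rw [div_mul_eq_mul_div, eq_div_iff hy] at hx
        rw [LinearMap.smul_apply, smul_eq_mul, div_mul_eq_mul_div, eq_div_iff hsy]
        linear_combination -hx
    have hx' : s x - s y / s' y * s' x ≠ 0 := sub_ne_zero.2 hx
    refine ⟨(s x - s y / s' y * s' x)⁻¹ • (x - (s' x / s' y) • y), ?_, ?_⟩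
    · simp only [map_smul, map_sub, smul_eq_mul]
      rw [show s' x / s' y * s y = s y / s' y * s' x by ring]
      exact inv_mul_cancel₀ hx'
    · simp only [map_smul, map_sub, smul_eq_mul]
      field_simp
      simp
  have sw : ∀ x y, l (c y x) = -l (c x y) := fun x y => by rw [BaerGroup.swap hc, map_neg]
  have hl4 : ∀ x, l (c x (b 4)) = 0 := fun x => by
    have : l (c (b 4) x) = 0 := congrArg (fun h : V →ₗ[F] F => h x) hb.h4
    rw [sw, this, neg_zero]
  have hvx : ∀ x, μ (c (b 4) x) = l (c v x) := fun x =>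
    (congrArg (fun f : V →ₗ[F] F => f x) hv).symm
  have hwx : ∀ x, ν (c (b 4) x) = l (c w x) := fun x =>
    (congrArg (fun f : V →ₗ[F] F => f x) hw).symm
  obtain ⟨b', b0, b1, b4, hb'⟩ := exists_symplecticBasis_of_rigid hc hV hu hl (b.ne_zero 4) hl4
    (v₀ := v) (v₁ := z) (by rw [← hvx]; exact hz1)
  rw [← b4] at hvx hwx hz1 hz2
  have swμ : ∀ x y, μ (c y x) = -μ (c x y) := fun x y => by rw [BaerGroup.swap hc, map_neg]
  have swν : ∀ x y, ν (c y x) = -ν (c x y) := fun x y => by rw [BaerGroup.swap hc, map_neg]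
  have m0 : μ (c (b' 4) (b' 0)) = 0 := by rw [hvx, b0, hc, map_zero]
  have m1 : μ (c (b' 4) (b' 1)) = 1 := by rw [hvx, ← b0]; exact hb'.h01
  have m2 : μ (c (b' 4) (b' 2)) = 0 := by rw [hvx, ← b0]; exact hb'.h02
  have m3 : μ (c (b' 4) (b' 3)) = 0 := by rw [hvx, ← b0]; exact hb'.h03
  have n0 : ν (c (b' 4) (b' 0)) = 0 := by rw [hwx, b0, sw, hvw, neg_zero]
  have n1 : ν (c (b' 4) (b' 1)) = 0 := by rw [b1]; exact hz2
  -- In the basis b' the contraction of μ is x₁ and that of ν is n₂x₂ + n₃x₃ ≠ 0; it is completed to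
  -- a pair of determinant one.
  obtain ⟨α, γ, hαγ⟩ : ∃ α γ : F,
      ν (c (b' 4) (b' 2)) * γ - ν (c (b' 4) (b' 3)) * α = 1 := by
    by_cases h2 : ν (c (b' 4) (b' 2)) = 0
    · by_cases h3 : ν (c (b' 4) (b' 3)) = 0
      · refine absurd (b'.ext fun i => ?_) (b4 ▸ hinj 0)
        fin_cases i <;> simp [n0, n1, h2, h3, hc]
      · exact ⟨-(ν (c (b' 4) (b' 3)))⁻¹, 0, by simp [h3]⟩
    · exact ⟨0, (ν (c (b' 4) (b' 2)))⁻¹, by simp [h2]⟩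
  -- For β = -μ ⊗ x₀ + ν ⊗ (αx₂ + γx₃), the part of the cyclic sum involving x₄ is x₄ ∧ (x₀ ∧ x₁ +
  -- (n₂γ - n₃α) x₂ ∧ x₃) = x₄ ∧ ω. Thus t = 1, while rigidity demands t = 0.
  have hβ := jac_eq_zero_of_rigid hc hu hl hb' (t := 1)
    (β := tensorForm μ (-b'.coord 0) + tensorForm ν (α • b'.coord 2 + γ • b'.coord 3))
    (LinearMap.ext fun x => by simp [hμ, hν])
    (by simp [jac, swμ (b' 4), swν (b' 4), m0, m1, n0, n1])
    (by simp [jac, swμ (b' 4), swν (b' 4), m0, m2, n0])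
    (by simp [jac, swμ (b' 4), swν (b' 4), m0, m3, n0])
    (by simp [jac, swμ (b' 4), swν (b' 4), m1, m2, n1])
    (by simp [jac, swμ (b' 4), swν (b' 4), m1, m3, n1])
    (by
      simp [jac, swμ (b' 4), swν (b' 4), m2, m3]
      linear_combination hαγ)
  exact one_ne_zero hβ.1

end Rigid

/-! ### The three model maps -/

section Models

variable (F : Type*) [Field F] {n : ℕ}

/-- The alternating form `xᵢ ∧ xⱼ` on `Fⁿ`. -/
def wedge (i j : Fin n) : (Fin n → F) →ₗ[F] (Fin n → F) →ₗ[F] F :=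
  LinearMap.mk₂ F (fun x y => x i * y j - x j * y i)
    (fun _ _ _ => by simp only [Pi.add_apply]; ring)
    (fun _ _ _ => by simp only [Pi.smul_apply, smul_eq_mul]; ring)
    (fun _ _ _ => by simp only [Pi.add_apply]; ring)
    (fun _ _ _ => by simp only [Pi.smul_apply, smul_eq_mul]; ring)

@[simp] theorem wedge_apply (i j : Fin n) (x y : Fin n → F) :
    wedge F i j x y = x i * y j - x j * y i := rfl

variable {F}

/-- The bilinear map with given coordinate forms. -/
def formMap {m : ℕ} (ω : Fin m → (Fin n → F) →ₗ[F] (Fin n → F) →ₗ[F] F) :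
    (Fin n → F) →ₗ[F] (Fin n → F) →ₗ[F] (Fin m → F) :=
  LinearMap.mk₂ F (fun x y k => ω k x y)
    (fun _ _ _ => by ext; simp) (fun _ _ _ => by ext; simp)
    (fun _ _ _ => by ext; simp) (fun _ _ _ => by ext; simp)

@[simp] theorem formMap_apply {m : ℕ} (ω : Fin m → (Fin n → F) →ₗ[F] (Fin n → F) →ₗ[F] F)
    (x y : Fin n → F) (k : Fin m) : formMap ω x y k = ω k x y := rfl

variable (F)

/-- One form of rank four in dimension five. -/
def mapOne : (Fin 5 → F) →ₗ[F] (Fin 5 → F) →ₗ[F] (Fin 1 → F) :=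
  formMap ![wedge F 0 1 + wedge F 2 3]

/-- The forms `x₀ ∧ x₁ + x₂ ∧ x₃` and `x₂ ∧ x₄`. -/
def mapTwo : (Fin 5 → F) →ₗ[F] (Fin 5 → F) →ₗ[F] (Fin 2 → F) :=
  formMap ![wedge F 0 1 + wedge F 2 3, wedge F 2 4]

/-- The forms `x₀ ∧ x₁ + x₂ ∧ x₃`, `x₂ ∧ x₄` and `x₃ ∧ x₄`. -/
def mapThree : (Fin 5 → F) →ₗ[F] (Fin 5 → F) →ₗ[F] (Fin 3 → F) :=
  formMap ![wedge F 0 1 + wedge F 2 3, wedge F 2 4, wedge F 3 4]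

end Models

/-- Equivalence of bilinear maps. -/
def FormEquiv {F V U V' U' : Type*} [Field F] [AddCommGroup V] [Module F V] [AddCommGroup U]
    [Module F U] [AddCommGroup V'] [Module F V'] [AddCommGroup U'] [Module F U']
    (c : V →ₗ[F] V →ₗ[F] U) (c' : V' →ₗ[F] V' →ₗ[F] U') : Prop :=
  ∃ (P : V ≃ₗ[F] V') (Q : U ≃ₗ[F] U'), ∀ x y, Q (c x y) = c' (P x) (P y)

/-! ### Classification of rigid bilinear maps -/

section Classify

variable {F V U : Type*} [Field F] [AddCommGroup V] [Module F V] [AddCommGroup U] [Module F U]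
  {c : V →ₗ[F] V →ₗ[F] U} {u₀ : U}

theorem exists_equiv_of_linearIndependent {k : ℕ} (φ : Fin k → U →ₗ[F] F)
    (hφ : LinearIndependent F φ) (h : ∀ u, (∀ i, φ i u = 0) → u = 0) :
    ∃ Q : U ≃ₗ[F] (Fin k → F), ∀ u i, Q u i = φ i u := by
  have hinj : Function.Injective (LinearMap.pi φ) := by
    rw [← LinearMap.ker_eq_bot, LinearMap.ker_eq_bot']
    exact fun u hu => h u fun i => congrFun hu i
  have : FiniteDimensional F U := FiniteDimensional.of_injective _ hinj
  have h1 : finrank F U ≤ k := by simpa using LinearMap.finrank_le_finrank_of_injective hinj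
  have h2 : k ≤ finrank F U := by
    have := hφ.fintype_card_le_finrank
    rw [Fintype.card_fin] at this
    exact this.trans_eq (Subspace.dual_finrank_eq (K := F) (V := U))
  exact ⟨LinearMap.linearEquivOfInjective _ hinj (by simpa using le_antisymm h1 h2),
    fun u i => rfl⟩

/-- In the new coordinates y₀, …, y₄ the form x₀ ∧ x₁ + x₂ ∧ x₃ becomes y₂ ∧ y₃ + y₀ ∧ y₁: the
hyperbolic pairs are exchanged so that the one interacting with y₄ comes second, as in the models.
The parameters in y₄ absorb the remaining coefficients of the other forms. -/
theorem exists_equiv_of_basis (b : Basis (Fin 5) F V) (A B C D : F) :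
    ∃ P : V ≃ₗ[F] (Fin 5 → F), ∀ x, P x = ![b.coord 2 x, b.coord 3 x, -b.coord 1 x, b.coord 0 x,
      b.coord 4 x + A * b.coord 0 x + D * b.coord 1 x - B * b.coord 2 x - C * b.coord 3 x] := by
  have : FiniteDimensional F V := b.finiteDimensional_of_finite
  let f : V →ₗ[F] (Fin 5 → F) := LinearMap.pi ![b.coord 2, b.coord 3, -b.coord 1, b.coord 0,
    b.coord 4 + A • b.coord 0 + D • b.coord 1 - B • b.coord 2 - C • b.coord 3]
  have hf : ∀ x, f x = ![b.coord 2 x, b.coord 3 x, -b.coord 1 x, b.coord 0 x,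
      b.coord 4 x + A * b.coord 0 x + D * b.coord 1 x - B * b.coord 2 x - C * b.coord 3 x] :=
    fun x => by
      ext i
      fin_cases i <;> simp [f]
  have hinj : Function.Injective f := by
    rw [← LinearMap.ker_eq_bot, LinearMap.ker_eq_bot']
    intro x hx
    rw [hf] at hx
    have h2 : b.coord 2 x = 0 := congrFun hx 0
    have h3 : b.coord 3 x = 0 := congrFun hx 1
    have h1 : b.coord 1 x = 0 := neg_eq_zero.1 (congrFun hx 2)
    have h0 : b.coord 0 x = 0 := congrFun hx 3
    have h4 : b.coord 4 x + A * b.coord 0 x + D * b.coord 1 x - B * b.coord 2 x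
        - C * b.coord 3 x = 0 := congrFun hx 4
    rw [h0, h1, h2, h3] at h4
    refine b.forall_coord_eq_zero_iff.1 fun i => ?_
    fin_cases i
    · exact h0
    · exact h1
    · exact h2
    · exact h3
    · simpa using h4
  exact ⟨LinearMap.linearEquivOfInjective f hinj (by simp [finrank_eq_card_basis b]), hf⟩

/-- Bilinear maps in dimension five for which some nonzero `u₀` is annihilated by all forms
satisfying the Jacobi identity. -/
theorem classification (hc : ∀ x, c x x = 0)
    (hs : Submodule.span F (Set.range fun x : V × V => c x.1 x.2) = ⊤) (hV : finrank F V = 5)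
    (hu₀ : u₀ ≠ 0) (hu : ∀ β, IsJacobi c β → β u₀ = 0) :
    FormEquiv c (mapOne F) ∨ FormEquiv c (mapTwo F) ∨ FormEquiv c (mapThree F) := by
  obtain ⟨l, hl⟩ : ∃ l : U →ₗ[F] F, l u₀ = 1 := by
    obtain ⟨f, hf⟩ : ∃ f : U →ₗ[F] F, f u₀ ≠ 0 := by
      by_contra hf
      push Not at hf
      exact hu₀ ((Module.forall_dual_apply_eq_zero_iff F u₀).1 hf)
    exact ⟨(f u₀)⁻¹ • f, by simp [hf]⟩
  -- Every functional is a multiple of l plus a functional killing u₀.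
  have hzero : ∀ u, l u = 0 → (∀ μ : U →ₗ[F] F, μ u₀ = 0 → μ u = 0) → u = 0 := fun u h1 h2 =>
    (Module.forall_dual_apply_eq_zero_iff F u).1 fun φ => by
      have := h2 (φ - φ u₀ • l) (by simp [hl])
      simpa [h1] using this
  have hω : ∀ x, c.compr₂ l x x = 0 := fun x => by simp [hc]
  have sw : ∀ (μ : U →ₗ[F] F) x y, μ (c y x) = -μ (c x y) := fun μ x y => by
    rw [BaerGroup.swap hc, map_neg]
  have hlexp : ∀ {b : Basis (Fin 5) F V}, IsSymplecticBasis (c.compr₂ l) b → ∀ x y,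
      l (c x y) = b.coord 0 x * b.coord 1 y - b.coord 1 x * b.coord 0 y
        + (b.coord 2 x * b.coord 3 y - b.coord 3 x * b.coord 2 y) := fun {b} hb x y => by
    have h4 : ∀ x, c.compr₂ l x (b 4) = 0 := fun x => by
      rw [BaerGroup.swap hω, hb.h4, LinearMap.zero_apply, neg_zero]
    have := alternating_expand hω b x y
    rw [hb.h01, hb.h02, hb.h03, hb.h12, hb.h13, hb.h23, h4, h4, h4, h4] at this
    rw [LinearMap.compr₂_apply] at this
    rw [this]
    ring
  obtain ⟨b, hb⟩ := exists_symplecticBasis hc hV hu hl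
  have hl4 : ∀ x, l (c x (b 4)) = 0 := fun x => by
    have : l (c (b 4) x) = 0 := congrArg (fun h : V →ₗ[F] F => h x) hb.h4
    rw [sw, this, neg_zero]
  have hdual : ∀ μ : U →ₗ[F] F, ∃ v, c.compr₂ l v = contract c (b 4) μ := fun μ =>
    hb.exists_dual hω (by simp [hc])
  choose d hd using hdual
  have hdx : ∀ μ x, μ (c (b 4) x) = l (c (d μ) x) := fun μ x =>
    (congrArg (fun f : V →ₗ[F] F => f x) (hd μ)).symm
  -- Here μ ∘ c = x₄ ∧ x₁ + σ with σ in x₀, …, x₃. The cyclic sum of μ ⊗ x₁ is σ ∧ x₁, free of x₄,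
  -- so it vanishes and σ is divisible by x₁.
  have hsigma : ∀ {b' : Basis (Fin 5) F V}, IsSymplecticBasis (c.compr₂ l) b' →
      ∀ {μ : U →ₗ[F] F}, μ u₀ = 0 → μ (c (b' 4) (b' 0)) = 0 → μ (c (b' 4) (b' 1)) = 1 →
        μ (c (b' 4) (b' 2)) = 0 → μ (c (b' 4) (b' 3)) = 0 →
        μ (c (b' 0) (b' 2)) = 0 ∧ μ (c (b' 0) (b' 3)) = 0 ∧ μ (c (b' 2) (b' 3)) = 0 := by
    intro b' hb' μ hμ m0 m1 m2 m3
    obtain ⟨-, t1, t2, -, t3⟩ := jac_eq_zero_of_rigid hc hu hl hb' (t := 0)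
      (β := tensorForm μ (contract c (b' 4) μ)) (LinearMap.ext fun x => by simp [hμ])
      (by simp [jac, sw μ (b' 4), hc, m0, m1]) (by simp [jac, sw μ (b' 4), hc, m0, m2])
      (by simp [jac, sw μ (b' 4), hc, m0, m3]) (by simp [jac, sw μ (b' 4), hc, m1, m2])
      (by simp [jac, sw μ (b' 4), hc, m1, m3]) (by simp [jac, sw μ (b' 4), hc, m2, m3])
    simp only [jac, tensorForm_apply, contract_apply, m0, m1, m2, m3, mul_zero, mul_one, zero_add,
      add_zero] at t1 t2 t3
    exact ⟨by rw [sw, t1, neg_zero], by rw [sw, t2, neg_zero], t3⟩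
  -- The vectors d μ, for μ killing u₀, carry the symplectic form l ∘ c. Either two of them pair
  -- nontrivially, or all are orthogonal and the functionals killing u₀ form a space of dimension at
  -- most one.
  by_cases hC : ∃ μ ν : U →ₗ[F] F, μ u₀ = 0 ∧ ν u₀ = 0 ∧ l (c (d μ) (d ν)) ≠ 0
  · right; right
    obtain ⟨μ, ν', hμ, hν', hκ⟩ := hC
    obtain ⟨ν, v, hν, hv, hvx⟩ : ∃ (ν : U →ₗ[F] F) (v : V), ν u₀ = 0 ∧ l (c (d μ) v) = 1 ∧
        ∀ x, ν (c (b 4) x) = l (c v x) :=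
      ⟨(l (c (d μ) (d ν')))⁻¹ • ν', (l (c (d μ) (d ν')))⁻¹ • d ν', by simp [hν'], by simp [hκ],
        fun x => by rw [LinearMap.smul_apply, hdx ν' x]; simp⟩
    have hμ0 : μ ≠ 0 := by
      rintro rfl
      have := hdx 0 v
      rw [hv] at this
      simp at this
    -- Subtracting the right multiple of ν makes φ orthogonal to μ, hence proportional to it.
    have hspan : ∀ φ : U →ₗ[F] F, φ u₀ = 0 → ∃ a a' : F, φ = a • μ + a' • ν := fun φ hφ => by
      obtain ⟨a, ha⟩ := proportional_of_isotropic hc hs hV hu hl hb hμ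
        (ν := φ - l (c (d μ) (d φ)) • ν) (by simp [hφ, hν]) hμ0 (hd μ)
        (w := d φ - l (c (d μ) (d φ)) • v)
        (LinearMap.ext fun x => by simp [← hdx φ x, ← hvx x]) (by simp [hv])
      exact ⟨a, _, sub_eq_iff_eq_add.1 ha⟩
    obtain ⟨b', b0, b1, b4, hb'⟩ := exists_symplecticBasis_of_rigid hc hV hu hl (b.ne_zero 4) hl4 hv
    have hmx : ∀ x, μ (c (b' 4) x) = l (c (b' 0) x) := by rw [b4, b0]; exact hdx μ
    have hnx : ∀ x, ν (c (b' 4) x) = l (c (b' 1) x) := by rw [b4, b1]; exact hvx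
    have m0 : μ (c (b' 4) (b' 0)) = 0 := by rw [hmx, hc, map_zero]
    have m1 : μ (c (b' 4) (b' 1)) = 1 := by rw [hmx]; exact hb'.h01
    have m2 : μ (c (b' 4) (b' 2)) = 0 := by rw [hmx]; exact hb'.h02
    have m3 : μ (c (b' 4) (b' 3)) = 0 := by rw [hmx]; exact hb'.h03
    have n0 : ν (c (b' 4) (b' 0)) = -1 := by rw [hnx, sw]; exact congrArg _ hb'.h01
    have n1 : ν (c (b' 4) (b' 1)) = 0 := by rw [hnx, hc, map_zero]
    have n2 : ν (c (b' 4) (b' 2)) = 0 := by rw [hnx]; exact hb'.h12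
    have n3 : ν (c (b' 4) (b' 3)) = 0 := by rw [hnx]; exact hb'.h13
    obtain ⟨m02, m03, m23⟩ := hsigma hb' hμ m0 m1 m2 m3
    -- The same argument as for μ: the contraction of ν is -x₀, so the part of ν ∘ c free of x₄ is
    -- divisible by x₀.
    obtain ⟨-, t1, t2, t3, -⟩ := jac_eq_zero_of_rigid hc hu hl hb' (t := 0)
      (β := tensorForm ν (contract c (b' 4) ν)) (LinearMap.ext fun x => by simp [hν])
      (by simp [jac, sw ν (b' 4), hc, n0, n1]) (by simp [jac, sw ν (b' 4), hc, n0, n2])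
      (by simp [jac, sw ν (b' 4), hc, n0, n3]) (by simp [jac, sw ν (b' 4), hc, n1, n2])
      (by simp [jac, sw ν (b' 4), hc, n1, n3]) (by simp [jac, sw ν (b' 4), hc, n2, n3])
    simp only [jac, tensorForm_apply, contract_apply, n0, n1, n2, n3, mul_zero, mul_neg, mul_one,
      zero_add, add_zero, neg_eq_zero] at t1 t2 t3
    -- The polarized form -μ ⊗ x₀ + ν ⊗ x₁ matches the coefficients of μ ∘ c and ν ∘ c, so that a
    -- single y₄ serves both: μ ∘ c = y₂ ∧ y₄ and ν ∘ c = y₃ ∧ y₄.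
    obtain ⟨-, r1, r2, -, -⟩ := jac_eq_zero_of_rigid hc hu hl hb' (t := 0)
      (β := tensorForm μ (contract c (b' 4) ν) + tensorForm ν (contract c (b' 4) μ))
      (LinearMap.ext fun x => by simp [hν, hμ])
      (by simp [jac, sw ν (b' 4), sw μ (b' 4), hc, n0, n1, m0, m1])
      (by simp [jac, sw ν (b' 4), sw μ (b' 4), hc, n0, n2, m0, m2])
      (by simp [jac, sw ν (b' 4), sw μ (b' 4), hc, n0, n3, m0, m3])
      (by simp [jac, sw ν (b' 4), sw μ (b' 4), hc, n1, n2, m1, m2])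
      (by simp [jac, sw ν (b' 4), sw μ (b' 4), hc, n1, n3, m1, m3])
      (by simp [jac, sw ν (b' 4), sw μ (b' 4), hc, n2, n3, m2, m3])
    simp only [jac, LinearMap.add_apply, tensorForm_apply, contract_apply, n0, n1, n2, n3, m0, m1,
      m2, m3, mul_zero, mul_neg, mul_one, zero_add, add_zero] at r1 r2
    rw [sw ν (b' 0) (b' 2)] at r1
    rw [sw ν (b' 0) (b' 3)] at r2
    obtain ⟨P, hP⟩ := exists_equiv_of_basis b' (μ (c (b' 0) (b' 1))) (μ (c (b' 1) (b' 2)))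
      (μ (c (b' 1) (b' 3))) (ν (c (b' 0) (b' 1)))
    obtain ⟨Q, hQ⟩ := exists_equiv_of_linearIndependent ![l, μ, ν]
      (by
        rw [Fintype.linearIndependent_iff]
        intro a ha
        rw [Fin.sum_univ_three] at ha
        have e : ∀ u, a 0 * l u + a 1 * μ u + a 2 * ν u = 0 := fun u => by
          simpa using congrArg (fun f : U →ₗ[F] F => f u) ha
        have a0 : a 0 = 0 := by simpa [hl, hμ, hν] using e u₀
        have a1 : a 1 = 0 := by simpa [m1, n1, a0] using e (c (b' 4) (b' 1))
        have a2 : a 2 = 0 := by simpa [m0, n0, a0] using e (c (b' 4) (b' 0))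
        intro i
        fin_cases i <;> assumption)
      (fun u h => hzero u (h 0) fun φ hφ => by
        obtain ⟨x, y, rfl⟩ := hspan φ hφ
        have h1 : μ u = 0 := h 1
        have h2 : ν u = 0 := h 2
        simp [h1, h2])
    refine ⟨P, Q, fun x y => funext fun k => ?_⟩
    rw [hQ, hP, hP]
    fin_cases k
    · simp only [mapThree, formMap_apply]
      simp [hlexp hb']
      ring
    · have e := alternating_expand (θ := c.compr₂ μ) (fun x => by simp [hc]) b' x y
      simp only [LinearMap.compr₂_apply, sw μ (b' 4), m0, m1, m2, m3, m02, m03, m23] at e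
      simp [mapThree]
      simp only [Basis.coord_apply] at e
      linear_combination e
    · have e := alternating_expand (θ := c.compr₂ ν) (fun x => by simp [hc]) b' x y
      simp only [LinearMap.compr₂_apply, sw ν (b' 4), n0, n1, n2, n3, t1, t2, t3] at e
      simp [mapThree]
      simp only [Basis.coord_apply] at e
      rw [e]
      linear_combination
        (-(b'.repr x 0 * b'.repr y 2 - b'.repr x 2 * b'.repr y 0)) * r1
        - (b'.repr x 0 * b'.repr y 3 - b'.repr x 3 * b'.repr y 0) * r2
  push Not at hC
  by_cases hB : ∃ μ : U →ₗ[F] F, μ u₀ = 0 ∧ μ ≠ 0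
  · right; left
    obtain ⟨μ, hμ, hμ0⟩ := hB
    have hspan : ∀ φ : U →ₗ[F] F, φ u₀ = 0 → ∃ a : F, φ = a • μ := fun φ hφ =>
      proportional_of_isotropic hc hs hV hu hl hb hμ hφ hμ0 (hd μ) (hd φ) (hC μ φ hμ hφ)
    obtain ⟨z, hz⟩ : ∃ z, l (c (d μ) z) = 1 := by
      have : contract c (b 4) μ ≠ 0 := fun h =>
        hμ0 (eq_zero_of_contract_eq_zero hc hs hu hl hb hμ h)
      obtain ⟨y, hy⟩ := DFunLike.ne_iff.1 this
      have hy' : l (c (d μ) y) ≠ 0 := by rw [← hdx]; exact hy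
      exact ⟨(l (c (d μ) y))⁻¹ • y, by simp [hy']⟩
    obtain ⟨b', b0, b1, b4, hb'⟩ := exists_symplecticBasis_of_rigid hc hV hu hl (b.ne_zero 4) hl4 hz
    have hmx : ∀ x, μ (c (b' 4) x) = l (c (b' 0) x) := by rw [b4, b0]; exact hdx μ
    have m0 : μ (c (b' 4) (b' 0)) = 0 := by rw [hmx, hc, map_zero]
    have m1 : μ (c (b' 4) (b' 1)) = 1 := by rw [hmx]; exact hb'.h01
    have m2 : μ (c (b' 4) (b' 2)) = 0 := by rw [hmx]; exact hb'.h02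
    have m3 : μ (c (b' 4) (b' 3)) = 0 := by rw [hmx]; exact hb'.h03
    obtain ⟨m02, m03, m23⟩ := hsigma hb' hμ m0 m1 m2 m3
    -- The last parameter multiplies x₁, which disappears in y₂ ∧ y₄ with y₂ = -x₁; it may be 0.
    obtain ⟨P, hP⟩ := exists_equiv_of_basis b' (μ (c (b' 0) (b' 1))) (μ (c (b' 1) (b' 2)))
      (μ (c (b' 1) (b' 3))) 0
    obtain ⟨Q, hQ⟩ := exists_equiv_of_linearIndependent ![l, μ]
      (by
        rw [Fintype.linearIndependent_iff]
        intro a ha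
        rw [Fin.sum_univ_two] at ha
        have e : ∀ u, a 0 * l u + a 1 * μ u = 0 := fun u => by
          simpa using congrArg (fun f : U →ₗ[F] F => f u) ha
        have a0 : a 0 = 0 := by simpa [hl, hμ] using e u₀
        have a1 : a 1 = 0 := by simpa [m1, a0] using e (c (b' 4) (b' 1))
        intro i
        fin_cases i <;> assumption)
      (fun u h => hzero u (h 0) fun φ hφ => by
        obtain ⟨x, rfl⟩ := hspan φ hφ
        have h1 : μ u = 0 := h 1
        simp [h1])
    refine ⟨P, Q, fun x y => funext fun k => ?_⟩
    rw [hQ, hP, hP]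
    fin_cases k
    · simp only [mapTwo, formMap_apply]
      simp [hlexp hb']
      ring
    · have e := alternating_expand (θ := c.compr₂ μ) (fun x => by simp [hc]) b' x y
      simp only [LinearMap.compr₂_apply, sw μ (b' 4), m0, m1, m2, m3, m02, m03, m23] at e
      simp [mapTwo]
      simp only [Basis.coord_apply] at e
      linear_combination e
  · left
    push Not at hB
    obtain ⟨P, hP⟩ := exists_equiv_of_basis b 0 0 0 0
    obtain ⟨Q, hQ⟩ := exists_equiv_of_linearIndependent ![l]
      (by
        rw [Fintype.linearIndependent_iff]
        intro a ha
        rw [Fin.sum_univ_one] at ha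
        have a0 : a 0 = 0 := by simpa [hl] using congrArg (fun f : U →ₗ[F] F => f u₀) ha
        intro i
        fin_cases i
        exact a0)
      (fun u h => hzero u (h 0) fun φ hφ => by rw [hB φ hφ, LinearMap.zero_apply])
    refine ⟨P, Q, fun x y => funext fun k => ?_⟩
    rw [hQ, hP, hP]
    fin_cases k
    simp only [mapOne, formMap_apply]
    simp [hlexp hb]
    ring

end Classify

/-! ### An obstruction to capability -/

section NotCapable

variable {K : Type*} [Group K]

theorem commutator_mul_left_of_mem_center {z : K} (hz : z ∈ Subgroup.center K) (a b : K) :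
    ⁅z * a, b⁆ = ⁅a, b⁆ := by
  have h := Subgroup.mem_center_iff.1 hz (a * b * a⁻¹)
  calc ⁅z * a, b⁆ = z * (a * b * a⁻¹) * z⁻¹ * b⁻¹ := by rw [commutatorElement_def]; group
    _ = ⁅a, b⁆ := by rw [← h, mul_inv_cancel_right, commutatorElement_def]

theorem commutator_mul_right_of_mem_center {z : K} (hz : z ∈ Subgroup.center K) (a b : K) :
    ⁅a, z * b⁆ = ⁅a, b⁆ := by
  rw [← commutatorElement_inv, commutator_mul_left_of_mem_center hz, commutatorElement_inv]

/-- If `z` commutes with `a` and `b` modulo the center, then it commutes with `⁅a, b⁆`. -/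
theorem commutator_comm_of_mem_center {a b z : K} (ha : ⁅z, a⁆ ∈ Subgroup.center K)
    (hb : ⁅z, b⁆ ∈ Subgroup.center K) : z * ⁅a, b⁆ = ⁅a, b⁆ * z := by
  have h : z * ⁅a, b⁆ * z⁻¹ = ⁅⁅z, a⁆ * a, ⁅z, b⁆ * b⁆ := by
    simp only [commutatorElement_def]; group
  rw [commutator_mul_left_of_mem_center ha, commutator_mul_right_of_mem_center hb] at h
  exact mul_inv_eq_iff_eq_mul.1 h

/-- A central product of the subgroups generated by `x₀, x₁` and by `x₂, x₃, x₄` in which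
`⁅x₀, x₁⁆ = ⁅x₂, x₃⁆` is nontrivial is not capable. -/
theorem not_isCapable {G : Type u} [Group G] (x : Fin 5 → G)
    (hgen : Subgroup.closure (Set.range x) = ⊤) (h : ⁅x 0, x 1⁆ = ⁅x 2, x 3⁆)
    (hne : ⁅x 0, x 1⁆ ≠ 1) (h0 : ∀ i, 2 ≤ i → x i * x 0 = x 0 * x i)
    (h1 : ∀ i, 2 ≤ i → x i * x 1 = x 1 * x i) : ¬ IsCapable.{u, v} G := by
  rintro ⟨K, _, ⟨e⟩⟩
  let π : K →* G := e.symm.toMonoidHom.comp (QuotientGroup.mk' (Subgroup.center K))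
  have hπ : Function.Surjective π := e.symm.surjective.comp (QuotientGroup.mk'_surjective _)
  have hk : ∀ k, π k = 1 ↔ k ∈ Subgroup.center K := fun k => by
    rw [← QuotientGroup.eq_one_iff]
    exact MulEquiv.map_eq_one_iff e.symm
  choose y hy using fun i => hπ (x i)
  have hz : ∀ i j, x i * x j = x j * x i → ⁅y i, y j⁆ ∈ Subgroup.center K := fun i j hij => by
    rw [← hk, map_commutatorElement, hy, hy, commutatorElement_eq_one_iff_mul_comm, hij]
  have hge : ∀ i, 2 ≤ i → y i * ⁅y 0, y 1⁆ = ⁅y 0, y 1⁆ * y i := fun i hi =>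
    commutator_comm_of_mem_center (hz i 0 (h0 i hi)) (hz i 1 (h1 i hi))
  have hζ : ⁅y 0, y 1⁆ * ⁅y 2, y 3⁆⁻¹ ∈ Subgroup.center K := by
    rw [← hk, map_mul, map_inv, map_commutatorElement, map_commutatorElement, hy, hy, hy, hy, h,
      mul_inv_cancel]
  -- The commutators of y₀, y₁ and of y₂, y₃ differ by a central element, so they have the same
  -- centralizer. The second is centralized by y₀ and y₁ for the same reason that the first is
  -- centralized by y₂, y₃, y₄.
  have hlt : ∀ a, a * ⁅y 2, y 3⁆ = ⁅y 2, y 3⁆ * a → a * ⁅y 0, y 1⁆ = ⁅y 0, y 1⁆ * a := by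
    intro a ha
    have e1 : ⁅y 0, y 1⁆ = ⁅y 0, y 1⁆ * ⁅y 2, y 3⁆⁻¹ * ⁅y 2, y 3⁆ := by
      rw [inv_mul_cancel_right]
    rw [e1, ← mul_assoc, Subgroup.mem_center_iff.1 hζ a, mul_assoc, ha, mul_assoc, mul_assoc,
      mul_assoc]
  let C := Subgroup.centralizer {⁅y 0, y 1⁆}
  have hyC : ∀ i, y i ∈ C := fun i => by
    rw [Subgroup.mem_centralizer_singleton_iff]
    by_cases hi : 2 ≤ i
    · exact hge i hi
    · refine hlt _ (commutator_comm_of_mem_center (hz i 2 ?_) (hz i 3 ?_))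
      all_goals
        have : i = 0 ∨ i = 1 := by omega
        rcases this with rfl | rfl
      · exact (h0 2 le_rfl).symm
      · exact (h1 2 le_rfl).symm
      · exact (h0 3 (by decide)).symm
      · exact (h1 3 (by decide)).symm
  have hC : C.map π = ⊤ := by
    rw [eq_top_iff, ← hgen, Subgroup.closure_le]
    rintro _ ⟨i, rfl⟩
    exact ⟨y i, hyC i, hy i⟩
  refine hne ?_
  -- The centralizer C contains the kernel of π and maps onto G, so it is all of K.
  have : ⁅y 0, y 1⁆ ∈ Subgroup.center K := by
    rw [Subgroup.mem_center_iff]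
    intro k
    obtain ⟨a, haC, hak⟩ : π k ∈ C.map π := hC ▸ Subgroup.mem_top _
    have h3 : k * a⁻¹ ∈ Subgroup.center K := by
      rw [← hk, map_mul, map_inv, hak, mul_inv_cancel]
    have h4 : k * a⁻¹ ∈ C := Subgroup.center_le_centralizer _ h3
    have h5 : k ∈ C := by simpa using C.mul_mem h4 haC
    exact (Subgroup.mem_centralizer_singleton_iff.1 h5)
  rw [← hk, map_commutatorElement, hy, hy] at this
  exact this

end NotCapable

/-! ### Recognition of amalgamated direct products -/

section Amalgam

variable {A B M : Type*} [Group A] [Group B] [Group M]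

/-- Recognition of amalgamated direct products. -/
theorem isAmalgam_iff {G : Type*} [Group G] {α : A →* M} {β : B →* M}
    (hα : Function.Injective α) (hβ : Function.Injective β)
    (hcomm : ∀ a b, Commute (α a) (β b)) (hsurj : ∀ m, ∃ a b, α a * β b = m) {a₀ : A} {b₀ : B}
    (ha₀ : a₀ ∈ Subgroup.center A) (hb₀ : b₀ ∈ Subgroup.center B) (h₀ : α a₀ = β b₀)
    (hint : ∀ a b, α a = β b → a ∈ Subgroup.zpowers a₀) :
    IsAmalgam G a₀ b₀ ↔ Nonempty (G ≃* M) := by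
  have key : ∀ (H : Subgroup (Subgroup.center A)) (φ : H →* Subgroup.center B),
      H.map (Subgroup.center A).subtype = Subgroup.zpowers a₀ →
      (∃ h : H, ((h : Subgroup.center A) : A) = a₀ ∧ (φ h : B) = b₀) →
      Nonempty (AmalgamatedProduct H φ ≃* M) := by
    rintro H φ hH ⟨h, rfl, rfl⟩
    let Φ := α.noncommCoprod β hcomm
    have hΦ : Function.Surjective Φ := fun m => by
      obtain ⟨a, b, hab⟩ := hsurj m
      exact ⟨(a, b), hab⟩
    have hker : amalgamSubgroup H φ = Φ.ker := by
      ext ⟨a, b⟩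
      rw [MonoidHom.mem_ker]
      constructor
      · rintro ⟨g, hg⟩
        have hgz : ((g : Subgroup.center A) : A) ∈ Subgroup.zpowers _ :=
          hH ▸ Subgroup.mem_map_of_mem _ g.2
        obtain ⟨k, hk⟩ := hgz
        -- The subgroup H is generated by h, so φ is determined by its value there.
        have hgk : g = h ^ k := Subtype.ext (Subtype.ext (by simpa using hk.symm))
        rw [hg, hgk]
        simp only [Φ, MonoidHom.noncommCoprod_apply, map_zpow, map_inv, Subgroup.coe_zpow, h₀,
          mul_inv_cancel]
      · intro hab
        have hab' : α a = β b⁻¹ := by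
          rw [map_inv, ← mul_eq_one_iff_eq_inv]; exact hab
        obtain ⟨k, rfl⟩ := hint _ _ hab'
        refine ⟨h ^ k, Prod.ext (by simp) ?_⟩
        have : b⁻¹ = (φ h : B) ^ k := hβ (by rw [← hab', map_zpow, map_zpow, h₀])
        rw [← inv_inv b, this]
        simp
    exact ⟨(QuotientGroup.quotientMulEquivOfEq hker).trans
      (QuotientGroup.quotientKerEquivOfSurjective Φ hΦ)⟩
  constructor
  · rintro ⟨H, φ, hH, -, hh, ⟨e⟩⟩
    obtain ⟨f⟩ := key H φ hH hh
    exact ⟨e.trans f⟩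
  · rintro ⟨e⟩
    let H : Subgroup (Subgroup.center A) := Subgroup.zpowers ⟨a₀, ha₀⟩
    have hex : ∀ h : H, ∃ b : Subgroup.center B, β b = α (h : Subgroup.center A) := by
      rintro ⟨_, k, rfl⟩
      exact ⟨⟨b₀, hb₀⟩ ^ k, by simp [h₀]⟩
    choose ψ hψ using hex
    let φ : H →* Subgroup.center B := MonoidHom.mk' ψ fun x y => Subtype.ext (hβ (by simp [hψ]))
    have hφ : ∀ h, β (φ h) = α (h : Subgroup.center A) := hψ
    have hH : H.map (Subgroup.center A).subtype = Subgroup.zpowers a₀ := by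
      rw [MonoidHom.map_zpowers]; rfl
    have hh : ∃ h : H, ((h : Subgroup.center A) : A) = a₀ ∧ (φ h : B) = b₀ :=
      ⟨⟨⟨a₀, ha₀⟩, Subgroup.mem_zpowers _⟩, rfl, hβ (by rw [hφ, ← h₀])⟩
    obtain ⟨f⟩ := key H φ hH hh
    refine ⟨H, φ, hH, fun x y hxy => ?_, hh, ⟨e.trans f.symm⟩⟩
    exact Subtype.ext (Subtype.ext (hα (by rw [← hφ, ← hφ, hxy])))

end Amalgam

/-! ### 2-nilpotent products of cyclic groups of order p -/

section PowPrime

variable {G : Type*} [Group G]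

theorem pow_mul_eq_commutator_pow (hcomm : ∀ x y z : G, ⁅x, y⁆ * z = z * ⁅x, y⁆) (x y : G) (n : ℕ) :
    y ^ n * x = ⁅y, x⁆ ^ n * (x * y ^ n) := by
  induction n with
  | zero => simp
  | succ n ih =>
    have e : y * x = ⁅y, x⁆ * (x * y) := by rw [commutatorElement_def]; group
    calc y ^ (n + 1) * x = y ^ n * (y * x) := by rw [pow_succ, mul_assoc]
      _ = ⁅y, x⁆ * (y ^ n * x) * y := by rw [e, ← mul_assoc, ← hcomm]; simp only [mul_assoc]
      _ = ⁅y, x⁆ ^ (n + 1) * (x * y ^ (n + 1)) := by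
        rw [ih, pow_succ' ⁅y, x⁆, pow_succ y]; simp only [mul_assoc]

/-- Collecting the x's to the left in (xy)ⁿ moves one y past one x n(n - 1)/2 times, each time
producing the central commutator. -/
theorem mul_pow_of_commutator_comm (hcomm : ∀ x y z : G, ⁅x, y⁆ * z = z * ⁅x, y⁆) (x y : G)
    (n : ℕ) : (x * y) ^ n = ⁅y, x⁆ ^ n.choose 2 * (x ^ n * y ^ n) := by
  have hc : ∀ (k : ℕ) (z : G), ⁅y, x⁆ ^ k * z = z * ⁅y, x⁆ ^ k := fun k z =>
    (Commute.pow_left (hcomm y x z) k : Commute _ _)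
  induction n with
  | zero => simp
  | succ n ih =>
    calc (x * y) ^ (n + 1) = ⁅y, x⁆ ^ n.choose 2 * (x ^ n * (y ^ n * x) * y) := by
          rw [pow_succ, ih]; simp only [mul_assoc]
      _ = ⁅y, x⁆ ^ n.choose 2 * (⁅y, x⁆ ^ n * x ^ n * (x * y ^ n) * y) := by
          rw [pow_mul_eq_commutator_pow hcomm x y n, ← mul_assoc (x ^ n), ← hc n (x ^ n)]
      _ = ⁅y, x⁆ ^ (n + 1).choose 2 * (x ^ (n + 1) * y ^ (n + 1)) := by
          have : (n + 1).choose 2 = n.choose 2 + n := by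
            rw [Nat.choose_succ_succ' n 1, Nat.choose_one_right, add_comm]
          rw [this, pow_add, pow_succ x, pow_succ y]
          simp only [mul_assoc]

/-- A group of class two generated by elements of order dividing an odd `p` has exponent
dividing `p`. -/
theorem isClassTwoExp_of_closure {p : ℕ} (hodd : Odd p)
    (hcomm : ∀ x y z : G, ⁅x, y⁆ * z = z * ⁅x, y⁆) {S : Set G} (hS : Subgroup.closure S = ⊤)
    (hp : ∀ x ∈ S, x ^ p = 1) : IsClassTwoExp p G := by
  refine ⟨hodd, hcomm, fun x => ?_⟩
  have hx : x ∈ Subgroup.closure S := hS ▸ Subgroup.mem_top x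
  induction hx using Subgroup.closure_induction with
  | mem x hx => exact hp x hx
  | one => exact one_pow p
  | mul x y _ _ hx hy =>
    have h1 : ⁅y, x⁆ ^ p = 1 := by
      have := pow_mul_eq_commutator_pow hcomm x y p
      rw [hy, one_mul, mul_one] at this
      exact (mul_eq_right.1 this.symm)
    obtain ⟨k, hk⟩ := hodd
    -- For odd p = 2k + 1 the binomial coefficient is a multiple of p, so the commutator factor in
    -- (xy)ᵖ disappears.
    have h2 : p.choose 2 = p * k := by
      rw [Nat.choose_two_right, hk, Nat.add_sub_cancel, mul_comm 2 k, ← mul_assoc,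
        Nat.mul_div_cancel _ two_pos]
    rw [mul_pow_of_commutator_comm hcomm, hx, hy, h2, pow_mul, h1, one_pow, one_mul, one_mul]
  | inv x _ hx => rw [inv_pow, hx, inv_one]

end PowPrime

namespace NilCyclic

variable {p n : ℕ}

theorem eq_top_of_gen_mem (P : Subgroup (NilCyclic p n)) (hP : ∀ i, gen p n i ∈ P) : P = ⊤ := by
  rw [eq_top_iff]
  rintro x -
  obtain ⟨y, rfl⟩ := QuotientGroup.mk_surjective x
  induction y using Monoid.CoprodI.induction_on with
  | one => exact P.one_mem
  | of i m =>
    obtain ⟨k, hk⟩ := ZMod.intCast_surjective (Multiplicative.toAdd m)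
    have hm : m = (Multiplicative.ofAdd (1 : ZMod p)) ^ k := by
      rw [← ofAdd_zsmul, zsmul_one, hk, ofAdd_toAdd]
    rw [hm, map_zpow, QuotientGroup.mk_zpow]
    exact P.zpow_mem (hP i) k
  | mul x y hx hy => exact P.mul_mem hx hy

theorem closure_range_gen : Subgroup.closure (Set.range (gen p n)) = ⊤ :=
  eq_top_of_gen_mem _ fun i => Subgroup.subset_closure ⟨i, rfl⟩

theorem gen_pow (i : Fin n) : gen p n i ^ p = 1 := by
  rw [gen, ← QuotientGroup.mk_pow, ← map_pow, ← ofAdd_nsmul, nsmul_one, ZMod.natCast_self,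
    ofAdd_zero, map_one, QuotientGroup.mk_one]

theorem isClassTwoExp (hodd : Odd p) : IsClassTwoExp p (NilCyclic p n) :=
  isClassTwoExp_of_closure hodd
    (fun x y z => (Subgroup.mem_center_iff.1 (commutator_mem_center x y) z).symm)
    closure_range_gen (by rintro _ ⟨i, rfl⟩; exact gen_pow i)

/-- The universal property of the 2-nilpotent product of cyclic groups of order `p`. -/
theorem exists_hom {M : Type*} [Group M] [h : IsClassTwoExp p M] (y : Fin n → M) :
    ∃ φ : NilCyclic p n →* M, ∀ i, φ (gen p n i) = y i := by
  have hz : ∀ i, zmultiplesHom (Additive M) (Additive.ofMul (y i)) p = 0 := fun i => by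
    rw [zmultiplesHom_apply, natCast_zsmul, ← ofMul_pow, h.pow, ofMul_one]
  let f : ∀ i, Multiplicative (ZMod p) →* M := fun i =>
    AddMonoidHom.toMultiplicativeLeft (ZMod.lift p ⟨_, hz i⟩)
  have hf : ∀ i, f i (Multiplicative.ofAdd 1) = y i := fun i => by
    have h1 := ZMod.lift_coe p ⟨_, hz i⟩ 1
    rw [Int.cast_one] at h1
    refine (congrArg Additive.toMul h1).trans ?_
    simp
  let F := Monoid.CoprodI.lift f
  have hF : (⊤ : Subgroup (Monoid.CoprodI
      fun _ : Fin n => Multiplicative (ZMod p))).lowerCentralSeries 2 ≤ F.ker := by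
    change ⁅⁅(⊤ : Subgroup _), (⊤ : Subgroup _)⁆, (⊤ : Subgroup _)⁆ ≤ F.ker
    have hle : ⁅(⊤ : Subgroup (Monoid.CoprodI fun _ : Fin n => Multiplicative (ZMod p))), ⊤⁆
        ≤ (Subgroup.center M).comap F := by
      rw [Subgroup.commutator_le]
      intro a _ b _
      rw [Subgroup.mem_comap, map_commutatorElement, Subgroup.mem_center_iff]
      exact fun g => (h.comm _ _ g).symm
    rw [Subgroup.commutator_le]
    intro a ha b _
    rw [MonoidHom.mem_ker, map_commutatorElement, commutatorElement_eq_one_iff_mul_comm]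
    exact (Subgroup.mem_center_iff.1 (hle ha) _).symm
  refine ⟨QuotientGroup.lift _ F hF, fun i => ?_⟩
  rw [gen, QuotientGroup.lift_mk, Monoid.CoprodI.lift_of, hf]

end NilCyclic

/-! ### Amalgamated products as Baer groups -/

section Presentation

variable {p : ℕ} [Fact p.Prime]

open BaerLie in
/-- A group generated by `n` elements whose commutators satisfy the relations of `c` is a quotient
of the Baer group of `c`, compatibly with a homomorphism to another Baer group that is given on
the generators. -/
theorem exists_surjective_baerGroup {n m : ℕ}
    {c : (Fin n → ZMod p) →ₗ[ZMod p] (Fin n → ZMod p) →ₗ[ZMod p] (Fin m → ZMod p)}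
    (hc : ∀ x, c x x = 0)
    (hs : Submodule.span (ZMod p)
      (Set.range fun x : (Fin n → ZMod p) × (Fin n → ZMod p) => c x.1 x.2) = ⊤)
    {H : Type*} [Group H] [h : IsClassTwoExp p H] {y : Fin n → H}
    (hy : Subgroup.closure (Set.range y) = ⊤) {z : Fin m → BaerLie p H}
    (hz : ∀ k x, bracket p (z k) x = 0)
    (hzc : ∀ v w, ∑ k, c v w k • z k
      = bracket p (∑ i, v i • of p (y i)) (∑ i, w i • of p (y i)))
    {V U : Type*} [AddCommGroup V] [Module (ZMod p) V] [AddCommGroup U] [Module (ZMod p) U]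
    {c' : V →ₗ[ZMod p] V →ₗ[ZMod p] U} {ι : (Fin n → ZMod p) →ₗ[ZMod p] V}
    {j : (Fin m → ZMod p) →ₗ[ZMod p] U} (hιj : ∀ v w, j (c v w) = c' (ι v) (ι w))
    {α : H →* BaerGroup c'} (hα : ∀ i, α (y i) = ⟨ι (Pi.single i 1), 0⟩) :
    ∃ L : BaerGroup c →* H, Function.Surjective L ∧
      ∀ x, α (L x) = ⟨ι x.fst, j x.snd⟩ := by
  let f : (Fin n → ZMod p) →ₗ[ZMod p] BaerLie p H :=
    Fintype.linearCombination (ZMod p) fun i => of p (y i)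
  let g : (Fin m → ZMod p) →ₗ[ZMod p] BaerLie p H := Fintype.linearCombination (ZMod p) z
  let L : BaerGroup c →* H := lift p f g
    (fun u x => by
      simp only [g, Fintype.linearCombination_apply, map_sum, map_smul, LinearMap.sum_apply,
        LinearMap.smul_apply, hz, smul_zero, Finset.sum_const_zero])
    (fun v w => by simpa only [f, g, Fintype.linearCombination_apply] using hzc v w)
  have hL : ∀ i, L ⟨Pi.single i 1, 0⟩ = y i := fun i => by
    apply (of p).injective
    rw [of_lift, map_zero, add_zero]
    simp [f]
  -- The elements (eᵢ, 0) generate the source, so homomorphisms from it are compared on them.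
  have hgen := BaerGroup.eq_top_of_span hc (ZMod.two_ne_zero_of_odd h.odd)
    (Pi.basisFun (ZMod p) (Fin n)).span_eq hs
  refine ⟨L, ?_, ?_⟩
  · rw [← MonoidHom.range_eq_top, eq_top_iff, ← hy, Subgroup.closure_le]
    rintro _ ⟨i, rfl⟩
    exact ⟨_, hL i⟩
  · let δ : BaerGroup c →* BaerGroup c' := MonoidHom.mk' (fun x => ⟨ι x.fst, j x.snd⟩) fun x y => by
      ext <;> simp [hιj]
    have : (α.comp L).eqLocus δ = ⊤ := hgen _ fun i => by
      change α (L _) = _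
      rw [Pi.basisFun_apply, hL, hα]
      simp [δ]
    intro x
    have hx : x ∈ (α.comp L).eqLocus δ := this ▸ Subgroup.mem_top x
    exact hx

theorem span_eq_top_of_single {n m : ℕ} {F : Type*} [Field F]
    {c : (Fin n → F) →ₗ[F] (Fin n → F) →ₗ[F] (Fin m → F)}
    (h : ∀ k, ∃ x y, c x y = Pi.single k 1) :
    Submodule.span F (Set.range fun x : (Fin n → F) × (Fin n → F) => c x.1 x.2) = ⊤ := by
  rw [eq_top_iff, ← (Pi.basisFun F (Fin m)).span_eq]
  apply Submodule.span_mono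
  rintro _ ⟨k, rfl⟩
  obtain ⟨x, y, hxy⟩ := h k
  exact ⟨(x, y), by simpa using hxy⟩

/-- The inclusion of the first two coordinates. -/
def inclTwo (F : Type*) [Field F] : (Fin 2 → F) →ₗ[F] (Fin 5 → F) where
  toFun v := ![v 0, v 1, 0, 0, 0]
  map_add' x y := by ext i; fin_cases i <;> simp
  map_smul' a x := by ext i; fin_cases i <;> simp

/-- The inclusion of the last three coordinates. -/
def inclThree (F : Type*) [Field F] : (Fin 3 → F) →ₗ[F] (Fin 5 → F) where
  toFun v := ![0, 0, v 0, v 1, v 2]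
  map_add' x y := by ext i; fin_cases i <;> simp
  map_smul' a x := by ext i; fin_cases i <;> simp

theorem inclTwo_apply {F : Type*} [Field F] (v : Fin 2 → F) :
    inclTwo F v = ![v 0, v 1, 0, 0, 0] := rfl

theorem inclThree_apply {F : Type*} [Field F] (v : Fin 3 → F) :
    inclThree F v = ![0, 0, v 0, v 1, v 2] := rfl

open BaerLie in
/-- Amalgamated products of the Heisenberg group with a three-generator group as Baer groups. -/
theorem isAmalgam_iff_baerGroup (hodd : Odd p) {m : ℕ}
    {cB : (Fin 3 → ZMod p) →ₗ[ZMod p] (Fin 3 → ZMod p) →ₗ[ZMod p] (Fin (m + 1) → ZMod p)}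
    (hcB : ∀ x, cB x x = 0)
    (hsB : Submodule.span (ZMod p)
      (Set.range fun x : (Fin 3 → ZMod p) × (Fin 3 → ZMod p) => cB x.1 x.2) = ⊤)
    (h10 : cB (Pi.single 1 1) (Pi.single 0 1) = -Pi.single 0 1)
    {cM : (Fin 5 → ZMod p) →ₗ[ZMod p] (Fin 5 → ZMod p) →ₗ[ZMod p] (Fin (m + 1) → ZMod p)}
    (hcM : ∀ x, cM x x = 0)
    (hAA : ∀ v w, cM (inclTwo _ v) (inclTwo _ w) = Pi.single 0 (wedge _ 0 1 v w))
    (hBB : ∀ v w, cM (inclThree _ v) (inclThree _ w) = cB v w)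
    (hAB : ∀ v w, cM (inclTwo _ v) (inclThree _ w) = 0)
    {B : Type*} [Group B] [hB : IsClassTwoExp p B] {y : Fin 3 → B}
    (hy : Subgroup.closure (Set.range y) = ⊤) {z : Fin (m + 1) → BaerLie p B}
    (hz : ∀ k x, bracket p (z k) x = 0)
    (hzc : ∀ v w, ∑ k, cB v w k • z k
      = bracket p (∑ i, v i • of p (y i)) (∑ i, w i • of p (y i)))
    {β : B →* BaerGroup cM} (hβ : ∀ i, β (y i) = ⟨inclThree _ (Pi.single i 1), 0⟩)
    {G : Type*} [Group G] :
    IsAmalgam G ⁅NilCyclic.gen p 2 1, NilCyclic.gen p 2 0⁆ ⁅y 1, y 0⁆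
      ↔ Nonempty (G ≃* BaerGroup cM) := by
  have h2 := ZMod.two_ne_zero_of_odd hodd
  have hA := NilCyclic.isClassTwoExp (n := 2) hodd
  have hM := BaerGroup.isClassTwoExp hodd hcM
  obtain ⟨α, hα⟩ := NilCyclic.exists_hom (p := p) (M := BaerGroup cM) fun i : Fin 2 =>
    ⟨inclTwo _ (Pi.single i 1), 0⟩
  obtain ⟨LB, hLB, hβL⟩ := exists_surjective_baerGroup hcB hsB hy hz hzc
    (c' := cM) (ι := inclThree _) (j := LinearMap.id) (fun v w => (hBB v w).symm) hβ
  obtain ⟨LA, hLA, hαL⟩ := exists_surjective_baerGroup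
    (c := formMap ![wedge (ZMod p) (0 : Fin 2) 1])
    (fun x => by ext k; fin_cases k; simp [mul_comm])
    (span_eq_top_of_single fun k => ⟨Pi.single 0 1, Pi.single 1 1, by
      ext i; fin_cases k; fin_cases i; simp⟩)
    NilCyclic.closure_range_gen
    (z := fun _ => bracket p (of p (NilCyclic.gen p 2 0)) (of p (NilCyclic.gen p 2 1)))
    (fun k x => bracket_bracket p _ _ x)
    (fun v w => by
      simp only [Fin.sum_univ_two, map_add, map_smul, LinearMap.add_apply, LinearMap.smul_apply,
        bracket_self, bracket_swap p (of p (NilCyclic.gen p 2 0)) (of p (NilCyclic.gen p 2 1)),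
        Finset.univ_unique, Finset.sum_singleton, formMap_apply]
      simp only [Fin.default_eq_zero, Matrix.cons_val_zero, wedge_apply]
      module)
    (c' := cM) (ι := inclTwo _)
    (j := (LinearMap.single (ZMod p) (fun _ : Fin (m + 1) => ZMod p) 0).comp (LinearMap.proj 0))
    (fun v w => by rw [hAA]; rfl) hα
  -- The composite α ∘ LA is explicit and injective while LA is onto, so α is injective without a
  -- normal form in the 2-nilpotent product.
  have hαi : Function.Injective α := by
    rw [injective_iff_map_eq_one]
    intro a ha
    obtain ⟨⟨v, u⟩, rfl⟩ := hLA a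
    rw [hαL] at ha
    have h1 : inclTwo _ v = 0 := congrArg BaerGroup.fst ha
    have h3 : (Pi.single 0 (u 0) : Fin (m + 1) → ZMod p) = 0 := congrArg BaerGroup.snd ha
    have hv : v = 0 := by
      ext i; fin_cases i
      · exact congrFun h1 0
      · exact congrFun h1 1
    have hu : u = 0 := by
      ext i; fin_cases i
      have h5 : u 0 = 0 := by simpa using congrFun h3 0
      exact h5
    rw [hv, hu]
    exact map_one LA
  have hβi : Function.Injective β := by
    rw [injective_iff_map_eq_one]
    intro b hb
    obtain ⟨⟨v, u⟩, rfl⟩ := hLB b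
    rw [hβL] at hb
    have h1 : inclThree _ v = 0 := congrArg BaerGroup.fst hb
    have hu : u = 0 := congrArg BaerGroup.snd hb
    have hv : v = 0 := by
      ext i; fin_cases i
      · exact congrFun h1 2
      · exact congrFun h1 3
      · exact congrFun h1 4
    rw [hv, hu]
    exact map_one LB
  have hαa : α ⁅NilCyclic.gen p 2 1, NilCyclic.gen p 2 0⁆ = ⟨0, -Pi.single 0 1⟩ := by
    rw [map_commutatorElement, hα, hα, BaerGroup.commutator_eq hcM h2, hAA]
    simp [Pi.single_neg]
  have hβb : β ⁅y 1, y 0⁆ = ⟨0, -Pi.single 0 1⟩ := by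
    rw [map_commutatorElement, hβ, hβ, BaerGroup.commutator_eq hcM h2, hBB, h10]
  refine isAmalgam_iff (α := α) (β := β) hαi hβi (fun a b => ?_) (fun x => ?_)
    (NilCyclic.commutator_mem_center _ _)
    (Subgroup.mem_center_iff.2 fun g => (hB.comm _ _ g).symm) (hαa.trans hβb.symm) fun a b hab => ?_
  · obtain ⟨a, rfl⟩ := hLA a
    obtain ⟨b, rfl⟩ := hLB b
    rw [hαL, hβL]
    exact (BaerGroup.commute_iff hcM h2 _ _).2 (hAB _ _)
  · refine ⟨LA ⟨![x.fst 0, x.fst 1], 0⟩, LB ⟨![x.fst 2, x.fst 3, x.fst 4], x.snd⟩, ?_⟩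
    rw [hαL, hβL]
    ext i
    · fin_cases i <;> simp [inclTwo_apply, inclThree_apply]
    · simp [hAB]
  · obtain ⟨⟨v, u⟩, rfl⟩ := hLA a
    obtain ⟨w, rfl⟩ := hLB b
    rw [hαL, hβL] at hab
    have h1 : inclTwo _ v = inclThree _ w.fst := congrArg BaerGroup.fst hab
    have hv : v = 0 := by
      ext i; fin_cases i
      · exact congrFun h1 0
      · exact congrFun h1 1
    -- The amalgamated commutator [x₂, x₁] corresponds to -e₀ rather than e₀, hence the sign.
    obtain ⟨k, hk⟩ := ZMod.natCast_zmod_surjective (-(u 0))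
    refine ⟨k, hαi ?_⟩
    simp only [zpow_natCast]
    rw [map_pow, hαa, hαL, BaerGroup.pow_eq hcM, hv]
    ext i
    · simp
    · have hk' : u 0 = -k := by rw [hk, neg_neg]
      rcases eq_or_ne i 0 with rfl | hi
      · simp [hk']
      · simp [hi]

end Presentation

section Alternating

variable (F : Type*) [Field F]

theorem mapOne_self (x : Fin 5 → F) : mapOne F x x = 0 := by
  ext k; fin_cases k; simp [mapOne, mul_comm]

theorem mapTwo_self (x : Fin 5 → F) : mapTwo F x x = 0 := by
  ext k; fin_cases k <;> simp [mapTwo, mul_comm]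

theorem mapThree_self (x : Fin 5 → F) : mapThree F x x = 0 := by
  ext k; fin_cases k <;> simp [mapThree, mul_comm]

/-- One form of rank four in dimension four. -/
def mapSymplectic : (Fin 4 → F) →ₗ[F] (Fin 4 → F) →ₗ[F] (Fin 1 → F) :=
  formMap ![wedge F 0 1 + wedge F 2 3]

theorem mapSymplectic_self (x : Fin 4 → F) : mapSymplectic F x x = 0 := by
  ext k; fin_cases k; simp [mapSymplectic, mul_comm]

end Alternating

theorem IsClassTwoExp.of_surjective {p : ℕ} {G H : Type*} [Group G] [Group H]
    (h : IsClassTwoExp p G) {f : G →* H} (hf : Function.Surjective f) : IsClassTwoExp p H where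
  odd := h.odd
  comm x y z := by
    obtain ⟨a, rfl⟩ := hf x
    obtain ⟨b, rfl⟩ := hf y
    obtain ⟨c, rfl⟩ := hf z
    rw [← map_commutatorElement, ← map_mul, h.comm, map_mul]
  pow x := by
    obtain ⟨a, rfl⟩ := hf x
    rw [← map_pow, h.pow, map_one]

/-! ### The three exceptional types and their models -/

section Types

variable {p : ℕ} [Fact p.Prime]

open BaerLie in
theorem isTypeII_iff (hodd : Odd p) {G : Type*} [Group G] :
    IsTypeII p G ↔ Nonempty (G ≃* BaerGroup (mapThree (ZMod p))) := by
  have hB := NilCyclic.isClassTwoExp (n := 3) hodd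
  have hM := BaerGroup.isClassTwoExp hodd (mapThree_self (ZMod p))
  obtain ⟨β, hβ⟩ := NilCyclic.exists_hom (p := p) (M := BaerGroup (mapThree (ZMod p)))
    fun i : Fin 3 => ⟨inclThree _ (Pi.single i 1), 0⟩
  let y := fun i => of p (NilCyclic.gen p 3 i)
  have hzc : ∀ v w : Fin 3 → ZMod p,
      ∑ k, formMap ![wedge (ZMod p) 0 1, wedge (ZMod p) 0 2, wedge (ZMod p) 1 2] v w k •
        (![bracket p (y 0) (y 1), bracket p (y 0) (y 2), bracket p (y 1) (y 2)] : Fin 3 → _) k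
      = bracket p (∑ i, v i • y i) (∑ i, w i • y i) := fun v w => by
    simp only [Fin.sum_univ_three, map_add, map_smul, LinearMap.add_apply, LinearMap.smul_apply,
      bracket_self, bracket_swap p (y 0) (y 1), bracket_swap p (y 0) (y 2),
      bracket_swap p (y 1) (y 2), formMap_apply]
    simp only [Matrix.cons_val_zero, Matrix.cons_val_one, Matrix.cons_val, wedge_apply]
    module
  refine isAmalgam_iff_baerGroup hodd
    (cB := formMap ![wedge (ZMod p) 0 1, wedge (ZMod p) 0 2, wedge (ZMod p) 1 2])
    (fun x => by ext k; fin_cases k <;> simp [mul_comm])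
    (span_eq_top_of_single fun k => by
      fin_cases k
      · exact ⟨Pi.single 0 1, Pi.single 1 1, by ext i; fin_cases i <;> simp⟩
      · exact ⟨Pi.single 0 1, Pi.single 2 1, by ext i; fin_cases i <;> simp⟩
      · exact ⟨Pi.single 1 1, Pi.single 2 1, by ext i; fin_cases i <;> simp⟩)
    (by ext i; fin_cases i <;> simp) (mapThree_self _)
    (fun v w => by ext i; fin_cases i <;> simp [mapThree, inclTwo_apply])
    (fun v w => by ext i; fin_cases i <;> simp [mapThree, inclThree_apply])
    (fun v w => by ext i; fin_cases i <;> simp [mapThree, inclTwo_apply, inclThree_apply])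
    NilCyclic.closure_range_gen
    (z := ![bracket p (y 0) (y 1), bracket p (y 0) (y 2), bracket p (y 1) (y 2)])
    (fun k x => by fin_cases k <;> exact bracket_bracket p _ _ x)
    hzc hβ

open BaerLie in
theorem isTypeIII_iff (hodd : Odd p) {G : Type*} [Group G] :
    IsTypeIII p G ↔ Nonempty (G ≃* BaerGroup (mapTwo (ZMod p))) := by
  have hB₀ := NilCyclic.isClassTwoExp (n := 3) hodd
  let N := Subgroup.zpowers ⁅NilCyclic.gen p 3 2, NilCyclic.gen p 3 1⁆
  have hsurj : Function.Surjective (QuotientGroup.mk' N) := QuotientGroup.mk'_surjective N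
  have hB : IsClassTwoExp p (NilCyclicThreeMod p) := hB₀.of_surjective hsurj
  have hM := BaerGroup.isClassTwoExp hodd (mapTwo_self (ZMod p))
  have h2 := ZMod.two_ne_zero_of_odd hodd
  obtain ⟨β₀, hβ₀⟩ := NilCyclic.exists_hom (p := p) (M := BaerGroup (mapTwo (ZMod p)))
    fun i : Fin 3 => ⟨inclThree _ (Pi.single i 1), 0⟩
  -- The map `mapTwo` has no component x₃ ∧ x₄, so the images of the last two generators commute.
  have hN : N ≤ β₀.ker := by
    rw [Subgroup.zpowers_le, MonoidHom.mem_ker, map_commutatorElement, hβ₀, hβ₀,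
      BaerGroup.commutator_eq (mapTwo_self _) h2]
    ext i
    · rfl
    · fin_cases i <;> simp [mapTwo, inclThree_apply]
  let g : Fin 3 → NilCyclicThreeMod p := fun i => QuotientGroup.mk' N (NilCyclic.gen p 3 i)
  have hβ : ∀ i, QuotientGroup.lift N β₀ hN (g i) = ⟨inclThree _ (Pi.single i 1), 0⟩ := hβ₀
  have hgen : Subgroup.closure (Set.range g) = ⊤ := by
    rw [show g = QuotientGroup.mk' N ∘ NilCyclic.gen p 3 from rfl, Set.range_comp,
      ← MonoidHom.map_closure, NilCyclic.closure_range_gen, ← MonoidHom.range_eq_map,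
      MonoidHom.range_eq_top.2 hsurj]
  let y := fun i => of p (g i)
  have hb21 : bracket p (y 2) (y 1) = 0 := by
    rw [bracket_of, ← map_commutatorElement, ← of_one]
    exact congrArg _ ((QuotientGroup.eq_one_iff _).2 (Subgroup.mem_zpowers _))
  have hb12 : bracket p (y 1) (y 2) = 0 := by rw [bracket_swap, hb21, neg_zero]
  have hzc : ∀ v w : Fin 3 → ZMod p,
      ∑ k, formMap ![wedge (ZMod p) 0 1, wedge (ZMod p) 0 2] v w k •
        (![bracket p (y 0) (y 1), bracket p (y 0) (y 2)] : Fin 2 → _) k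
      = bracket p (∑ i, v i • y i) (∑ i, w i • y i) := fun v w => by
    simp only [Fin.sum_univ_three, Fin.sum_univ_two, map_add, map_smul, LinearMap.add_apply,
      LinearMap.smul_apply, bracket_self, bracket_swap p (y 0) (y 1), bracket_swap p (y 0) (y 2),
      hb21, hb12, formMap_apply]
    simp only [Matrix.cons_val_zero, Matrix.cons_val_one, wedge_apply]
    module
  refine isAmalgam_iff_baerGroup hodd
    (cB := formMap ![wedge (ZMod p) 0 1, wedge (ZMod p) 0 2])
    (fun x => by ext k; fin_cases k <;> simp [mul_comm])
    (span_eq_top_of_single fun k => by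
      fin_cases k
      · exact ⟨Pi.single 0 1, Pi.single 1 1, by ext i; fin_cases i <;> simp⟩
      · exact ⟨Pi.single 0 1, Pi.single 2 1, by ext i; fin_cases i <;> simp⟩)
    (by ext i; fin_cases i <;> simp) (mapTwo_self _)
    (fun v w => by ext i; fin_cases i <;> simp [mapTwo, inclTwo_apply])
    (fun v w => by ext i; fin_cases i <;> simp [mapTwo, inclThree_apply])
    (fun v w => by ext i; fin_cases i <;> simp [mapTwo, inclTwo_apply, inclThree_apply])
    hgen (z := ![bracket p (y 0) (y 1), bracket p (y 0) (y 2)])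
    (fun k x => by fin_cases k <;> exact bracket_bracket p _ _ x)
    hzc hβ

/-- The fifth coordinate lies in the radical of the form of rank four and splits off as a direct
factor. -/
theorem isTypeI_iff {G : Type*} [Group G] :
    IsTypeI p (BaerGroup (mapSymplectic (ZMod p))) G
      ↔ Nonempty (G ≃* BaerGroup (mapOne (ZMod p))) := by
  let e : BaerGroup (mapSymplectic (ZMod p)) × Multiplicative (ZMod p)
      ≃* BaerGroup (mapOne (ZMod p)) :=
    { toFun := fun x => ⟨![x.1.fst 0, x.1.fst 1, x.1.fst 2, x.1.fst 3, x.2.toAdd], x.1.snd⟩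
      invFun := fun x => (⟨![x.fst 0, x.fst 1, x.fst 2, x.fst 3], x.snd⟩,
        Multiplicative.ofAdd (x.fst 4))
      left_inv := fun x => by
        refine Prod.ext (BaerGroup.ext ?_ rfl) rfl
        ext i; fin_cases i <;> rfl
      right_inv := fun x => by
        refine BaerGroup.ext ?_ rfl
        ext i; fin_cases i <;> rfl
      map_mul' := fun x y => by
        refine BaerGroup.ext ?_ ?_
        · ext i; fin_cases i <;> simp
        · ext i
          simp only [Prod.fst_mul, BaerGroup.mul_snd, Pi.add_apply, Pi.smul_apply]
          fin_cases i
          simp [mapOne, mapSymplectic] }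
  exact ⟨fun ⟨f⟩ => ⟨f.trans e⟩, fun ⟨f⟩ => ⟨f.trans e.symm⟩⟩

theorem BaerGroup.not_isCapable (hodd : Odd p) {m : ℕ}
    {c : (Fin 5 → ZMod p) →ₗ[ZMod p] (Fin 5 → ZMod p) →ₗ[ZMod p] (Fin m → ZMod p)}
    (hc : ∀ x, c x x = 0) (hs : ∀ k, ∃ x y, c x y = Pi.single k 1)
    (h : c (Pi.single 0 1) (Pi.single 1 1) = c (Pi.single 2 1) (Pi.single 3 1))
    (hne : c (Pi.single 0 1) (Pi.single 1 1) ≠ 0)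
    (h0 : ∀ i, 2 ≤ i → c (Pi.single i 1) (Pi.single 0 1) = 0)
    (h1 : ∀ i, 2 ≤ i → c (Pi.single i 1) (Pi.single 1 1) = 0)
    {G : Type u} [Group G] (e : G ≃* BaerGroup c) : ¬ IsCapable.{u, v} G := by
  have h2 := ZMod.two_ne_zero_of_odd hodd
  intro hG
  refine _root_.not_isCapable (G := BaerGroup c) (fun i => ⟨Pi.single i 1, 0⟩) ?_ ?_ ?_ ?_ ?_
    (hG.of_equiv e.symm)
  · exact eq_top_of_span hc h2 (Pi.basisFun (ZMod p) (Fin 5)).span_eq (span_eq_top_of_single hs) _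
      fun i => Subgroup.subset_closure ⟨i, by simp⟩
  · rw [commutator_eq hc h2, commutator_eq hc h2, h]
  · rw [commutator_eq hc h2]
    exact fun hh => hne (congrArg snd hh)
  · exact fun i hi => (commute_iff hc h2 _ _).2 (h0 i hi)
  · exact fun i hi => (commute_iff hc h2 _ _).2 (h1 i hi)

theorem not_isCapable_mapOne (hodd : Odd p) {G : Type u} [Group G]
    (e : G ≃* BaerGroup (mapOne (ZMod p))) : ¬ IsCapable.{u, v} G := by
  refine BaerGroup.not_isCapable hodd (mapOne_self _) ?_ ?_ ?_ ?_ ?_ e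
  · intro k
    fin_cases k
    exact ⟨Pi.single 0 1, Pi.single 1 1, by ext i; fin_cases i; simp [mapOne]⟩
  · ext i; fin_cases i; simp [mapOne]
  · intro h; simpa [mapOne] using congrFun h 0
  · intro i hi; ext k; fin_cases k; fin_cases i <;> simp_all [mapOne]
  · intro i hi; ext k; fin_cases k; fin_cases i <;> simp_all [mapOne]

theorem not_isCapable_mapTwo (hodd : Odd p) {G : Type u} [Group G]
    (e : G ≃* BaerGroup (mapTwo (ZMod p))) : ¬ IsCapable.{u, v} G := by
  refine BaerGroup.not_isCapable hodd (mapTwo_self _) ?_ ?_ ?_ ?_ ?_ e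
  · intro k
    fin_cases k
    · exact ⟨Pi.single 0 1, Pi.single 1 1, by ext i; fin_cases i <;> simp [mapTwo]⟩
    · exact ⟨Pi.single 2 1, Pi.single 4 1, by ext i; fin_cases i <;> simp [mapTwo]⟩
  · ext i; fin_cases i <;> simp [mapTwo]
  · intro h; simpa [mapTwo] using congrFun h 0
  · intro i hi; ext k; fin_cases k <;> fin_cases i <;> simp_all [mapTwo]
  · intro i hi; ext k; fin_cases k <;> fin_cases i <;> simp_all [mapTwo]

theorem not_isCapable_mapThree (hodd : Odd p) {G : Type u} [Group G]
    (e : G ≃* BaerGroup (mapThree (ZMod p))) : ¬ IsCapable.{u, v} G := by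
  refine BaerGroup.not_isCapable hodd (mapThree_self _) ?_ ?_ ?_ ?_ ?_ e
  · intro k
    fin_cases k
    · exact ⟨Pi.single 0 1, Pi.single 1 1, by ext i; fin_cases i <;> simp [mapThree]⟩
    · exact ⟨Pi.single 2 1, Pi.single 4 1, by ext i; fin_cases i <;> simp [mapThree]⟩
    · exact ⟨Pi.single 3 1, Pi.single 4 1, by ext i; fin_cases i <;> simp [mapThree]⟩
  · ext i; fin_cases i <;> simp [mapThree]
  · intro h; simpa [mapThree] using congrFun h 0
  · intro i hi; ext k; fin_cases k <;> fin_cases i <;> simp_all [mapThree]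
  · intro i hi; ext k; fin_cases k <;> fin_cases i <;> simp_all [mapThree]

end Types

/-! ### The extra-special group of order p⁵ and exponent p -/

section ExtraSpecial

variable {p : ℕ} [Fact p.Prime]

theorem mem_center_symplectic (hodd : Odd p) (x : BaerGroup (mapSymplectic (ZMod p))) :
    x ∈ Subgroup.center (BaerGroup (mapSymplectic (ZMod p))) ↔ x.fst = 0 := by
  have h2 := ZMod.two_ne_zero_of_odd hodd
  have hc := mapSymplectic_self (ZMod p)
  rw [Subgroup.mem_center_iff]
  constructor
  · intro h
    have key : ∀ i, mapSymplectic (ZMod p) (Pi.single i 1) x.fst 0 = 0 := fun i =>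
      congrFun ((BaerGroup.commute_iff hc h2 _ _).1 (h ⟨Pi.single i 1, 0⟩)) 0
    ext i
    fin_cases i
    · simpa [mapSymplectic] using key 1
    · simpa [mapSymplectic] using key 0
    · simpa [mapSymplectic] using key 3
    · simpa [mapSymplectic] using key 2
  · intro h g
    rw [BaerGroup.commute_iff hc h2, h, map_zero]

theorem isExtraSpecial_symplectic (hodd : Odd p) :
    IsExtraSpecial p (BaerGroup (mapSymplectic (ZMod p))) := by
  have h2 := ZMod.two_ne_zero_of_odd hodd
  have hc := mapSymplectic_self (ZMod p)
  refine ⟨fun x => ⟨1, by rw [pow_one, BaerGroup.pow_prime hc]⟩, ?_, le_antisymm ?_ ?_, fun x => ?_⟩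
  · let e : Subgroup.center (BaerGroup (mapSymplectic (ZMod p))) ≃ (Fin 1 → ZMod p) :=
      { toFun := fun x => x.1.snd
        invFun := fun u => ⟨⟨0, u⟩, (mem_center_symplectic hodd _).2 rfl⟩
        left_inv := fun x => Subtype.ext
          (BaerGroup.ext ((mem_center_symplectic hodd _).1 x.2).symm rfl)
        right_inv := fun u => rfl }
    rw [Nat.card_congr e]
    simp
  · rw [commutator_def, Subgroup.commutator_le]
    intro a _ b _
    rw [mem_center_symplectic hodd, BaerGroup.commutator_eq hc h2]
  · intro x hx
    rw [mem_center_symplectic hodd] at hx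
    have : x = ⁅(⟨Pi.single 0 1, 0⟩ : BaerGroup (mapSymplectic (ZMod p))),
        ⟨Pi.single 1 (x.snd 0), 0⟩⁆ := by
      rw [BaerGroup.commutator_eq hc h2]
      refine BaerGroup.ext hx ?_
      ext i; fin_cases i; simp [mapSymplectic]
    rw [this]
    exact Subgroup.commutator_mem_commutator (Subgroup.mem_top _) (Subgroup.mem_top _)
  · rw [BaerGroup.pow_prime hc]
    exact one_mem _

open BaerLie in
/-- Uniqueness of the extra-special group of order `p ^ 5` and exponent `p`. -/
theorem IsExtraSpecial.nonempty_equiv (hodd : Odd p) {E : Type*} [Group E]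
    (hE : IsExtraSpecial p E) (hcard : Nat.card E = p ^ 5) (hexp : Monoid.exponent E = p) :
    Nonempty (E ≃* BaerGroup (mapSymplectic (ZMod p))) := by
  have hp : p.Prime := Fact.out
  have hG : IsClassTwoExp p E := ⟨hodd, fun x y z => by
    have : ⁅x, y⁆ ∈ Subgroup.center E := hE.commutator_eq_center ▸
      Subgroup.commutator_mem_commutator (Subgroup.mem_top x) (Subgroup.mem_top y)
    exact (Subgroup.mem_center_iff.1 this z).symm, fun x => hexp ▸ Monoid.pow_exponent_eq_one x⟩
  have hfin : Finite E := Nat.finite_of_card_ne_zero (by rw [hcard]; exact pow_ne_zero _ hp.ne_zero)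
  have hfinL : Finite (BaerLie p E) := hfin
  -- Because center and commutator subgroup coincide, the derived subalgebra is exactly the center;
  -- so it has order p and the bracket is nondegenerate on a complement.
  have hmem : ∀ x : E, x ∈ Subgroup.center E ↔ of p x ∈ derived p E := fun x => by
    constructor
    · intro hx
      let S : Subgroup E :=
        { carrier := {x | of p x ∈ derived p E}
          one_mem' := zero_mem (derived p E)
          mul_mem' := fun {a b} ha hb => by
            change of p (a * b) ∈ derived p E
            rw [of_mul]
            exact add_mem (add_mem ha hb) (Submodule.smul_mem _ _ (bracket_mem_derived p _ _))
          inv_mem' := fun {a} ha => by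
            change of p a⁻¹ ∈ derived p E
            rw [of_inv]
            exact neg_mem ha }
      have hS : commutator E ≤ S := by
        rw [commutator_def, Subgroup.commutator_le]
        exact fun a _ b _ => bracket_mem_derived p (of p a) (of p b)
      exact hS (hE.commutator_eq_center ▸ hx)
    · intro hx
      rw [Subgroup.mem_center_iff]
      intro g
      have := bracket_eq_zero_of_mem_derived p hx (of p g)
      rw [bracket_of, ← of_one] at this
      exact (commutatorElement_eq_one_iff_mul_comm.1 ((of p).injective this)).symm
  have hD : Nat.card (derived p E) = p :=
    (Nat.card_congr ((of p).subtypeEquiv hmem)).symm.trans hE.card_center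
  obtain ⟨W, hW⟩ := (derived p E).exists_isCompl
  have hprod : Nat.card (derived p E) * Nat.card W = p ^ 5 := by
    rw [← hcard, ← Nat.card_prod]
    exact Nat.card_congr (((derived p E).prodEquivOfIsCompl W hW).toEquiv.trans (of p).symm)
  have hDr : finrank (ZMod p) (derived p E) = 1 := by
    have := Module.natCard_eq_pow_finrank (K := ZMod p) (V := derived p E)
    rw [hD, Nat.card_zmod] at this
    exact (Nat.pow_right_injective hp.two_le (by simpa using this)).symm
  have hWr : finrank (ZMod p) W = 4 := by
    have := Module.natCard_eq_pow_finrank (K := ZMod p) (V := W)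
    rw [hD, this, Nat.card_zmod, ← pow_succ'] at hprod
    have := Nat.pow_right_injective hp.two_le hprod
    omega
  obtain ⟨φ⟩ := BaerLie.nonempty_equiv p hW
  let Q : derived p E ≃ₗ[ZMod p] (Fin 1 → ZMod p) :=
    (finBasisOfFinrankEq (ZMod p) (derived p E) hDr).equivFun
  let ω : W →ₗ[ZMod p] W →ₗ[ZMod p] ZMod p :=
    (bracketOn p W).compr₂ ((LinearMap.proj 0).comp Q.toLinearMap)
  have hωQ : ∀ x y, Q (bracketOn p W x y) 0 = ω x y := fun x y => rfl
  have hω : ∀ x, ω x x = 0 := fun x => by rw [← hωQ, bracketOn_self, map_zero]; rfl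
  have hnd : ∀ x, ω x = 0 → x = 0 := fun x hx => by
    have h1 : ∀ y, bracketOn p W x y = 0 := fun y => by
      apply Q.injective
      rw [map_zero]
      ext i
      fin_cases i
      exact congrArg (fun f : W →ₗ[ZMod p] ZMod p => f y) hx
    have h3 : (x : BaerLie p E) ∈ derived p E := by
      obtain ⟨g, hg⟩ := (of p (G := E)).surjective x
      rw [← hg, ← hmem, Subgroup.mem_center_iff]
      intro k
      obtain ⟨d, hd, a, ha, hda⟩ : ∃ d ∈ derived p E, ∃ w ∈ W, d + w = of p k :=
        Submodule.mem_sup.1 (hW.sup_eq_top ▸ Submodule.mem_top)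
      have h4 : bracket p (of p g) (of p k) = 0 := by
        rw [← hda, map_add, bracket_swap p d, bracket_eq_zero_of_mem_derived p hd, neg_zero,
          zero_add, hg]
        exact congrArg Subtype.val (h1 ⟨a, ha⟩)
      rw [bracket_of, ← of_one] at h4
      exact (commutatorElement_eq_one_iff_mul_comm.1 ((of p).injective h4)).symm
    exact Subtype.ext (Submodule.disjoint_def.1 hW.disjoint _ h3 x.2)
  -- Two functionals on a 4-dimensional space have a common nonzero zero, which would lie in the
  -- radical.
  have hdec : ¬ ∃ f g : W →ₗ[ZMod p] ZMod p, ∀ x y, ω x y = f x * g y - f y * g x := by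
    rintro ⟨f, g, hfg⟩
    obtain ⟨e, he0, he⟩ := exists_ne_zero_of_card_lt_finrank ![f, g] (by omega)
    refine he0 (hnd e (LinearMap.ext fun y => ?_))
    have h0 : f e = 0 := he 0
    have h1 : g e = 0 := he 1
    rw [hfg, h0, h1]
    simp
  have : Nontrivial W := nontrivial_of_finrank_pos (R := ZMod p) (by omega)
  obtain ⟨a, ha⟩ := exists_ne (0 : W)
  obtain ⟨b, hb⟩ := DFunLike.ne_iff.1 (fun h => ha (hnd a h) : ω a ≠ 0)
  have hb' : ω a b ≠ 0 := hb
  obtain ⟨v, -, -, hv⟩ := exists_isSymplecticQuadruple hω hdec (v₀ := (ω a b)⁻¹ • a) (v₁ := b)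
    (by simp [hb'])
  let B := basisOfLinearIndependentOfCardEqFinrank (hv.linearIndependent hω) (by simp [hWr])
  have hB : ∀ i, B i = v i := fun i => by simp [B]
  have hform : ω = ((mapSymplectic (ZMod p)).compl₁₂ B.equivFun.toLinearMap
      B.equivFun.toLinearMap).compr₂ (LinearMap.proj 0) := by
    have sw := BaerGroup.swap hω
    refine LinearMap.ext_basis B B fun i j => ?_
    have hr : ∀ i j, B.repr (v i) j = if i = j then 1 else 0 := fun i j => by
      rw [← hB, B.repr_self_apply]
    rw [hB i, hB j]
    have h10 := sw (v 0) (v 1)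
    have h20 := sw (v 0) (v 2)
    have h30 := sw (v 0) (v 3)
    have h21 := sw (v 1) (v 2)
    have h31 := sw (v 1) (v 3)
    have h32 := sw (v 2) (v 3)
    fin_cases i <;> fin_cases j <;>
      simp [mapSymplectic, hr, hω, h10, h20, h30, h21, h31, h32, hv.h01, hv.h02,
        hv.h03, hv.h12, hv.h13, hv.h23]
  refine ⟨φ.trans (BaerGroup.congr B.equivFun Q fun x y => ?_)⟩
  ext i
  fin_cases i
  exact congrArg (fun f : W →ₗ[ZMod p] W →ₗ[ZMod p] ZMod p => f x y) hform

end ExtraSpecial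

/-! ### Conclusion -/

theorem FormEquiv.nonempty_mulEquiv {F V U V' U' : Type*} [Field F] [AddCommGroup V] [Module F V]
    [AddCommGroup U] [Module F U] [AddCommGroup V'] [Module F V'] [AddCommGroup U'] [Module F U']
    {c : V →ₗ[F] V →ₗ[F] U} {c' : V' →ₗ[F] V' →ₗ[F] U'} (h : FormEquiv c c') :
    Nonempty (BaerGroup c ≃* BaerGroup c') := by
  obtain ⟨P, Q, h⟩ := h
  exact ⟨BaerGroup.congr P Q h⟩

theorem BaerGroup.card_coordinates {p : ℕ} [Fact p.Prime] {n m : ℕ}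
    (c : (Fin n → ZMod p) →ₗ[ZMod p] (Fin n → ZMod p) →ₗ[ZMod p] (Fin m → ZMod p)) :
    Nat.card (BaerGroup c) = p ^ (n + m) := by
  rw [BaerGroup.card_eq, pow_add]
  simp

/-- The order is a power of p with exponent n + m, which separates the three models. -/
theorem eq_of_equiv_baerGroup {p : ℕ} [Fact p.Prime] {n m m' : ℕ} {G : Type*} [Group G]
    {c : (Fin n → ZMod p) →ₗ[ZMod p] (Fin n → ZMod p) →ₗ[ZMod p] (Fin m → ZMod p)}
    {c' : (Fin n → ZMod p) →ₗ[ZMod p] (Fin n → ZMod p) →ₗ[ZMod p] (Fin m' → ZMod p)}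
    (h : Nonempty (G ≃* BaerGroup c)) (h' : Nonempty (G ≃* BaerGroup c')) : m = m' := by
  obtain ⟨e⟩ := h
  obtain ⟨e'⟩ := h'
  have h1 := Nat.card_congr (e.symm.trans e').toEquiv
  rw [BaerGroup.card_coordinates, BaerGroup.card_coordinates] at h1
  have := Nat.pow_right_injective (Fact.out : p.Prime).two_le h1
  omega

theorem mainTheorem6 (p : ℕ) (hp : p.Prime) (hodd : Odd p) :
    ∃ (E : Type) (_ : Group E),
      -- `E` is the extra-special `p`-group of order `p ^ 5` and exponent `p`
      (IsExtraSpecial p E ∧ Nat.card E = p ^ 5 ∧ Monoid.exponent E = p) ∧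
      (∀ (E' : Type w) [Group E'], IsExtraSpecial p E' → Nat.card E' = p ^ 5 →
        Monoid.exponent E' = p → Nonempty (E' ≃* E)) ∧
      -- every minimally `5`-generated `G` of class at most two and exponent `p` is of exactly
      -- one of the four kinds
      ∀ (G : Type u) [Group G] [Group.FG G], Group.rank G = 5 → IsClassLE 2 G →
        Monoid.exponent G = p →
        (IsTypeI p E G ∨ IsTypeII p G ∨ IsTypeIII p G ∨ IsCapable.{u, v} G) ∧
        ¬ (IsTypeI p E G ∧ IsTypeII p G) ∧
        ¬ (IsTypeI p E G ∧ IsTypeIII p G) ∧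
        ¬ (IsTypeII p G ∧ IsTypeIII p G) ∧
        ¬ (IsTypeI p E G ∧ IsCapable.{u, v} G) ∧
        ¬ (IsTypeII p G ∧ IsCapable.{u, v} G) ∧
        ¬ (IsTypeIII p G ∧ IsCapable.{u, v} G) := by
  have : Fact p.Prime := ⟨hp⟩
  refine ⟨BaerGroup (mapSymplectic (ZMod p)), inferInstance,
    ⟨isExtraSpecial_symplectic hodd, BaerGroup.card_coordinates _,
      BaerGroup.exponent_eq (mapSymplectic_self _)⟩,
    fun E' _ h1 h2 h3 => h1.nonempty_equiv hodd h2 h3, fun G _ _ hrank hclass hexp => ?_⟩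
  rw [isTypeI_iff, isTypeII_iff hodd, isTypeIII_iff hodd]
  refine ⟨?_, fun h => ?_, fun h => ?_, fun h => ?_, fun ⟨⟨e⟩, h⟩ => not_isCapable_mapOne hodd e h,
    fun ⟨⟨e⟩, h⟩ => not_isCapable_mapThree hodd e h, fun ⟨⟨e⟩, h⟩ => not_isCapable_mapTwo hodd e h⟩
  · have hG : IsClassTwoExp p G :=
      ⟨hodd, isClassLE_two_iff.1 hclass, fun x => hexp ▸ Monoid.pow_exponent_eq_one x⟩
    have hco := BaerLie.exists_coordinates p (G := G)
    rw [hrank] at hco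
    obtain ⟨d, c, hc, hs, ⟨e⟩⟩ := hco
    -- Either the Jacobi forms detect every nonzero u and the group is capable, or a rigid u₀ exists
    -- and the classification applies.
    by_cases hcap : ∀ u, (∀ β, IsJacobi c β → β u = 0) → u = 0
    · exact Or.inr (Or.inr (Or.inr ((BaerGroup.isCapable (by norm_num) hc hcap).of_equiv e)))
    · push Not at hcap
      obtain ⟨u₀, hu, hu₀⟩ := hcap
      rcases classification hc hs (by simp) hu₀ hu with h | h | h <;>
        obtain ⟨f⟩ := h.nonempty_mulEquiv
      · exact Or.inl ⟨e.trans f⟩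
      · exact Or.inr (Or.inr (Or.inl ⟨e.trans f⟩))
      · exact Or.inr (Or.inl ⟨e.trans f⟩)
  · exact absurd (eq_of_equiv_baerGroup h.1 h.2) (by decide)
  · exact absurd (eq_of_equiv_baerGroup h.1 h.2) (by decide)
  · exact absurd (eq_of_equiv_baerGroup h.1 h.2) (by decide)
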